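/- Let $n\ge 1$, let $W$ be a real $M\times M_0$ matrix whose columns together with the all-ones vector $\mathbf 1_M$ are linearly independent, and for $\theta\in\mathbb R^{M_0}$ let $$p(\theta)=\frac{\exp\{W\theta\}}{\mathbf 1_M^T\exp\{W\theta\}}\in\mathbb R^M,\qquad \Sigma_{p}=\operatorname{diag}(p)-pp^T,$$ with $\exp$ taken componentwise. Let $\Theta\subseteq\mathbb R^{M_0}$ be the parameter space (for instance $\Theta=\mathbb R^{M_0}$), and let the true value $\theta_0$ be an interior point of $\Theta$. Let $X^{(\ell)}=(X^{(\ell)}_1,\dots,X^{(\ell)}_n)$, $\ell=1,2,\dots$, be independent (not necessarily identically distributed) random clusters with values in $\{1,\dots,M\}^n$, and let $Y^{(\ell)}_r=\#\{s: X^{(\ell)}_s=r\}$ be their cell counts. Suppose that for every $\ell$ $$\mathrm E[Y^{(\ell)}]=n\,p(\theta_0),\qquad \mathrm{Var}[Y^{(\ell)}]=\vartheta_n\, n\,\Sigma_{p(\theta_0)},\qquad \vartheta_n=1+(n-1)\rho^2,$$ for some $\rho^2\in[0,1]$. Nothing else is assumed on the law of $Y^{(\ell)}$. Let $\phi:(0,\infty)\to\mathbb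 R$ be convex with $\phi(1)=\phi'(1)=0$ and $\phi''(1)>0$, with the conventions $\phi(0)=\lim_{t\downarrow0}\phi(t)\in(-\infty,\infty]$, $0\,\phi(0/0)=0$ and $0\,\phi(q/0)=q\lim_{u\to\infty}\phi(u)/u$, and put $$d_\phi(q,p)=\sum_{r=1}^M p_r\,\phi(q_r/p_r),\qquad \widehat p=\widehat p_N=\frac1{nN}\sum_{\ell=1}^N Y^{(\ell)}.$$ For each $N\ge1$ let $\widehat\theta_\phi=\widehat\theta_{\phi,N}$ be a quasi minimum $\phi$-divergence estimator: a random vector in $\mathbb R^{M_0}$ which, for almost every sample for which $\theta\mapsto d_\phi(\widehat p_N,p(\theta))$ attains its minimum over $\Theta$, is a point of $\Theta$ at which the minimum is attained (its value for other samples is arbitrary). Then, as $N\to\infty$, with $\Sigma=\Sigma_{p(\theta_0)}$, i) $\sqrt N(\widehat\theta_\phi-\theta_0)$ converges in law to $\mathcal N\big(0,\tfrac{\vartheta_n}{n}(W^T\Sigma W)^{-1}\big)$; ii) $\sqrt N(p(\widehat\theta_\phi)-p(\theta_0))$ converges in law to $\mathcal N\big(0,\tfrac{\vartheta_n}{n}\,\Sigma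 W(W^T\Sigma W)^{-1}W^T\Sigma\big)$. -/

import Mathlib

open MeasureTheory ProbabilityTheory Filter Topology

noncomputable section

/-- The log-linear probability vector `p(θ) = exp(W θ) / (1ᵀ exp(W θ))`. -/
def loglinearProb {M M₀ : ℕ} (W : Matrix (Fin M) (Fin M₀) ℝ) (θ : EuclideanSpace ℝ (Fin M₀)) :
    EuclideanSpace ℝ (Fin M) :=
  WithLp.toLp 2 fun r =>
    Real.exp (W.mulVec θ.ofLp r) / ∑ s, Real.exp (W.mulVec θ.ofLp s)

/-- `Σ_p = D_p - p pᵀ`. -/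
def multinomialCov {M : ℕ} (p : EuclideanSpace ℝ (Fin M)) : Matrix (Fin M) (Fin M) ℝ :=
  Matrix.diagonal p.ofLp - Matrix.vecMulVec p.ofLp p.ofLp

/-- The number of the `n` units of one cluster that fall into category `r`. -/
def cellCount {M n : ℕ} (x : Fin n → Fin M) (r : Fin M) : ℝ :=
  ∑ s, if x s = r then 1 else 0

/-- The design effect `ϑ_n = 1 + (n - 1) ρ²`; `rhoSq` stands for the intracluster
correlation coefficient `ρ²`. -/
def designEffect (n : ℕ) (rhoSq : ℝ) : ℝ := 1 + ((n : ℝ) - 1) * rhoSq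

/-- The nonparametric estimator `p̂ = (n N)⁻¹ ∑_{ℓ} Y^(ℓ)` from the first `N` clusters
`x 0, …, x (N - 1)` of size `n`. -/
def pHat {M n : ℕ} (N : ℕ) (x : ℕ → Fin n → Fin M) : EuclideanSpace ℝ (Fin M) :=
  WithLp.toLp 2 fun r => ((n : ℝ) * N)⁻¹ * ∑ l ∈ Finset.range N, cellCount (x l) r

/-- The functions `φ` that generate divergences: convex on `(0, ∞)`, with `φ(1) = φ'(1) = 0`
and `φ''(1) > 0`. Nothing is required of the values of `φ` outside `(0, ∞)`. -/
structure IsPhiFunction (φ : ℝ → ℝ) : Prop where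
  convexOn : ConvexOn ℝ (Set.Ioi 0) φ
  map_one : φ 1 = 0
  hasDerivAt_one : HasDerivAt φ 0 1
  second_deriv_pos : ∃ c > 0, HasDerivAt (deriv φ) c 1

/-- The term `p φ(q / p)` of a divergence, for `p, q ≥ 0`. At `q = 0 < p` the value `φ(0)` is
`lim φ(t)` as `t ↓ 0` (possibly `+∞`); `0 φ(0 / 0) = 0` and
`0 φ(q / 0) = q lim φ(u) / u` as `u → ∞`. Both limits exist in `(-∞, ∞]` for convex `φ`,
so that the upper limits written here are limits. -/
def phiTerm (φ : ℝ → ℝ) (q p : ℝ) : EReal :=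
  if p = 0 then
    if q = 0 then 0 else (q : EReal) * limsup (fun u : ℝ => ((φ u / u : ℝ) : EReal)) atTop
  else if q = 0 then (p : EReal) * limsup (fun t : ℝ => ((φ t : ℝ) : EReal)) (𝓝[>] 0)
  else ((p * φ (q / p) : ℝ) : EReal)

/-- The `φ`-divergence `d_φ(q, p) = ∑ r, p_r φ(q_r / p_r)`. -/
def phiDivergence {M : ℕ} (φ : ℝ → ℝ) (q p : EuclideanSpace ℝ (Fin M)) : EReal :=
  ∑ r, phiTerm φ (q r) (p r)

/-- `t` is a minimizer over `Θ` of `θ ↦ d_φ(q, p(θ))`. -/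
def IsMinPhiDivergence {M M₀ : ℕ} (φ : ℝ → ℝ) (W : Matrix (Fin M) (Fin M₀) ℝ)
    (Θ : Set (EuclideanSpace ℝ (Fin M₀))) (q : EuclideanSpace ℝ (Fin M))
    (t : EuclideanSpace ℝ (Fin M₀)) : Prop :=
  t ∈ Θ ∧ IsMinOn (fun θ => phiDivergence φ q (loglinearProb W θ)) Θ t

/-- `T` is a quasi minimum `φ`-divergence estimator based on the first `N` of the clusters `X`:
a random vector that minimizes `d_φ(p̂, p(θ))` over `Θ` for (almost) every sample for which a
minimizer exists. For the other samples its value is arbitrary. -/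
structure IsQMPhiE {M M₀ n : ℕ} {Ω : Type*} [MeasurableSpace Ω] (P : Measure Ω)
    (φ : ℝ → ℝ) (W : Matrix (Fin M) (Fin M₀) ℝ) (Θ : Set (EuclideanSpace ℝ (Fin M₀)))
    (X : ℕ → Ω → Fin n → Fin M) (N : ℕ) (T : Ω → EuclideanSpace ℝ (Fin M₀)) : Prop where
  aemeasurable : AEMeasurable T P
  isMin : ∀ᵐ ω ∂P, (∃ t, IsMinPhiDivergence φ W Θ (pHat N fun l => X l ω) t) →
    IsMinPhiDivergence φ W Θ (pHat N fun l => X l ω) (T ω)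

/-- The clustered multinomial log-linear model with true parameter `θ₀`: independent clusters
`X l = (X_1, …, X_n)` with values in `{1, …, M}ⁿ`, whose count vectors have mean `n p(θ₀)` and
covariance matrix `ϑ_n n Σ_{p(θ₀)}`. The clusters need not be identically distributed. -/
structure IsClusteredMultinomial {M M₀ n : ℕ} {Ω : Type*} [MeasurableSpace Ω] (P : Measure Ω)
    (W : Matrix (Fin M) (Fin M₀) ℝ) (θ₀ : EuclideanSpace ℝ (Fin M₀)) (rhoSq : ℝ)
    (X : ℕ → Ω → Fin n → Fin M) : Prop where
  measurable : ∀ l, Measurable (X l)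
  indep : iIndepFun X P
  mean : ∀ l r, ∫ ω, cellCount (X l ω) r ∂P = n * loglinearProb W θ₀ r
  cov : ∀ l r s, cov[fun ω => cellCount (X l ω) r, fun ω => cellCount (X l ω) s; P] =
    designEffect n rhoSq * n * multinomialCov (loglinearProb W θ₀) r s

end

/-! ### Convex generators of divergences -/

namespace IsPhiFunction

variable {φ : ℝ → ℝ}

/-! The proof splits into a deterministic expansion of minimum divergence estimates and a central
limit theorem for `pHat`.

Deterministic part. Write w = p(θ₀), e = q - w, c = φ''(1) and J = ΣW, the Jacobian of the model at
θ₀. When q and p are both near w, d_φ(q, p) equals (c/2) ∑ (q_r - p_r)² / w_r up to o(‖q - p‖²). To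
first order a minimizer therefore solves a weighted least squares problem on the tangent space of
the model, with solution A e, A = (WᵀΣW)⁻¹Wᵀ; the factor c drops out, so the limit law does not
depend on φ. This is made rigorous by comparing values instead of solving estimating equations: the
minimizer t does at least as well as s = θ₀ + A e, and the normal equations
(`weightedInner_residual_eq_zero`) make the cross term between q - p(s) and p(s) - p(t) negligible,
whence p(s) - p(t) = o(‖e‖). A smooth left inverse of θ ↦ p(θ), built from logarithms, carries this
back to t - s (`isLittleO_of_isMinPhiDivergence`). Since Θ need not be compact, localization comes
from convexity: φ grows at least linearly away from 1, so the divergence stays bounded below once p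
is away from w (`exists_le_realPhiDivergence`). This gives both consistency and the existence of
minimizers for q near w.

Probabilistic part. p̂ - w is a mean of independent, uniformly bounded, centred vectors with the
common covariance (ϑ_n/n)Σ. The laws may differ, so the central limit theorem is proved with
characteristic functions (`tendstoInDistribution_inv_sqrt_smul_sum`). A second moment bound makes
the linearization error negligible after scaling by √N
(`tendstoInDistribution_of_asymptoticallyLinear`), and AΣAᵀ collapses to (WᵀΣW)⁻¹. -/

lemma continuousOn (hφ : IsPhiFunction φ) : ContinuousOn φ (Set.Ioi 0) :=
  hφ.convexOn.continuousOn isOpen_Ioi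

/-- A convex function with vanishing one-sided derivative at 1 has its global minimum there. -/
lemma nonneg (hφ : IsPhiFunction φ) {t : ℝ} (ht : 0 < t) : 0 ≤ φ t := by
  have hloc : IsMinOn φ (Set.Ioi 0) 1 := by
    refine hφ.convexOn.isMinOn_of_rightDeriv_eq_zero ?_ ?_
    · simp
    · exact hφ.hasDerivAt_one.hasDerivWithinAt.derivWithin (uniqueDiffWithinAt_Ioi 1)
  simpa [hφ.map_one] using hloc (show t ∈ Set.Ioi (0 : ℝ) from ht)

/-- Second order Peano expansion at `1`. -/
lemma peano (hφ : IsPhiFunction φ) {c : ℝ} (hc : 0 < c) (hd : HasDerivAt (deriv φ) c 1) :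
    (fun t => φ t - c / 2 * (t - 1) ^ 2) =o[𝓝 1] fun t => (t - 1) ^ 2 := by
  have hd1 : deriv φ 1 = 0 := hφ.hasDerivAt_one.deriv
  have hlo := hd.isLittleO
  simp only [hd1, sub_zero, smul_eq_mul] at hlo
  rw [Asymptotics.isLittleO_iff]
  intro ε hε
  -- The bound ε is what the conclusion needs; the bound c/2 forces differentiability of φ near 1.
  have h1 := hlo.def (c := min ε (c / 2)) (by positivity)
  obtain ⟨δ, hδ, hball⟩ := Metric.eventually_nhds_iff_ball.1 h1
  have hderiv : ∀ s ∈ Metric.ball (1 : ℝ) δ,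
      HasDerivAt (fun t => φ t - c / 2 * (t - 1) ^ 2) (deriv φ s - c * (s - 1)) s := by
    intro s hs
    have hφs : HasDerivAt φ (deriv φ s) s := by
      rcases eq_or_ne s 1 with rfl | hne
      · rw [hd1]; exact hφ.hasDerivAt_one
      -- At a point of non-differentiability `deriv` takes the value 0, and the bound would read c|s
      -- - 1| ≤ (c/2)|s - 1|.
      · refine DifferentiableAt.hasDerivAt (by_contra fun hnd => ?_)
        have := hball s hs
        rw [deriv_zero_of_not_differentiableAt hnd, zero_sub, norm_neg, norm_mul] at this
        have hpos : 0 < ‖s - 1‖ := norm_pos_iff.2 (sub_ne_zero.2 hne)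
        have h2 : ‖c‖ = c := Real.norm_of_nonneg hc.le
        rw [h2, mul_comm] at this
        have := le_of_mul_le_mul_right this hpos
        have := this.trans (min_le_right _ _)
        linarith
    have h2 : HasDerivAt (fun t : ℝ => c / 2 * (t - 1) ^ 2) (c * (s - 1)) s := by
      have := (((hasDerivAt_id s).sub_const 1).pow 2).const_mul (c / 2)
      convert! this using 1
      simp; ring
    exact hφs.sub h2
  filter_upwards [Metric.ball_mem_nhds (1 : ℝ) hδ] with t ht
  have hseg : segment ℝ 1 t ⊆ Metric.ball (1 : ℝ) δ :=
    (convex_ball (1 : ℝ) δ).segment_subset (Metric.mem_ball_self hδ) ht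
  have := (convex_segment (1 : ℝ) t).norm_image_sub_le_of_norm_hasDerivWithin_le
    (f := fun t => φ t - c / 2 * (t - 1) ^ 2) (f' := fun s => deriv φ s - c * (s - 1))
    (C := ε * ‖t - 1‖) (fun s hs => (hderiv s (hseg hs)).hasDerivWithinAt) ?_
    (left_mem_segment ℝ 1 t) (right_mem_segment ℝ 1 t)
  · simp only [hφ.map_one, sub_self] at this
    simp only [ne_eq, OfNat.ofNat_ne_zero, not_false_eq_true, zero_pow, mul_zero, sub_zero] at this
    rw [norm_pow, pow_two ‖t - 1‖, ← mul_assoc]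
    exact this
  · intro s hs
    have h3 := hball s (hseg hs)
    have h4 : ‖s - 1‖ ≤ ‖t - 1‖ := by
      rw [segment_eq_image_lineMap] at hs
      obtain ⟨a, ⟨ha0, ha1⟩, rfl⟩ := hs
      simp only [AffineMap.lineMap_apply, vsub_eq_sub, smul_eq_mul, vadd_eq_add]
      rw [add_sub_cancel_right, norm_mul, Real.norm_of_nonneg ha0]
      exact mul_le_of_le_one_left (norm_nonneg _) ha1
    rw [mul_comm (s - 1) c] at h3
    exact h3.trans (mul_le_mul (min_le_left _ _) h4 (norm_nonneg _) hε.le)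

/-- Linear growth away from `1`. -/
lemma eventually_exists_linear_le (hφ : IsPhiFunction φ) :
    ∀ᶠ η in 𝓝[>] (0 : ℝ), ∃ k > 0, ∀ t > 0, k * (|t - 1| - η) ≤ φ t := by
  obtain ⟨c, hc, hd⟩ := hφ.second_deriv_pos
  have h1 := (hφ.peano hc hd).def (c := c / 4) (by positivity)
  have h1' : ∀ᶠ t in 𝓝 (1 : ℝ), t ≠ 1 → 0 < φ t := by
    filter_upwards [h1] with t ht hne
    have hpos : 0 < (t - 1) ^ 2 := by have := sub_ne_zero.2 hne; positivity
    rw [Real.norm_of_nonneg hpos.le, Real.norm_eq_abs, abs_le] at ht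
    nlinarith [ht.1]
  have hplus : Tendsto (fun η : ℝ => 1 + η) (𝓝[>] 0) (𝓝 1) :=
    ((continuous_const.add continuous_id).tendsto' _ _ (by simp)).mono_left nhdsWithin_le_nhds
  have hminus : Tendsto (fun η : ℝ => 1 - η) (𝓝[>] 0) (𝓝 1) :=
    ((continuous_const.sub continuous_id).tendsto' _ _ (by simp)).mono_left nhdsWithin_le_nhds
  filter_upwards [hplus.eventually h1', hminus.eventually h1', self_mem_nhdsWithin,
    Ioo_mem_nhdsGT (show (0 : ℝ) < 1 by norm_num)] with η hp hm hη hη1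
  have hη : 0 < η := hη
  have hp := hp (by linarith)
  have hm := hm (by linarith)
  -- The slope of the lower of the two chords from (1, 0) to the graph at 1 ± η.
  refine ⟨min (φ (1 + η)) (φ (1 - η)) / η, by positivity, fun t ht => ?_⟩
  set m := min (φ (1 + η)) (φ (1 - η)) with hm_def
  have hmpos : 0 < m := lt_min hp hm
  -- Here s = 1 ± η lies between 1 and t, so convexity puts φ(s) below the chord from (1, 0) to (t,
  -- φ(t)).
  have key : ∀ s > 0, |s - 1| = η → η < |t - 1| → 0 < (s - 1) * (t - 1) →
      m ≤ φ s → m / η * |t - 1| ≤ φ t := by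
    intro s hs hs1 hst hsgn hms
    set a := η / |t - 1| with ha
    have htpos : 0 < |t - 1| := hη.trans hst
    have ha0 : 0 < a := by positivity
    have ha1 : a < 1 := (div_lt_one htpos).2 hst
    have hconv := hφ.convexOn.2 (show (1 : ℝ) ∈ Set.Ioi 0 by simp) (show t ∈ Set.Ioi 0 from ht)
      (show 0 ≤ 1 - a by linarith) ha0.le (by ring)
    have hcomb : (1 - a) • (1 : ℝ) + a • t = s := by
      have : s - 1 = a * (t - 1) := by
        rw [ha, ← hs1]
        rcases lt_or_ge (t - 1) 0 with h | h
        · have : s - 1 < 0 := by nlinarith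
          rw [abs_of_neg h, abs_of_neg this]; field_simp [h.ne]
        · have h' : 0 < t - 1 := lt_of_le_of_ne h (fun h0 => by simp [← h0] at htpos)
          have : 0 < s - 1 := pos_of_mul_pos_left hsgn h'.le
          rw [abs_of_pos h', abs_of_pos this]; field_simp
      simp only [smul_eq_mul]; linarith
    rw [hcomb, hφ.map_one] at hconv
    simp only [smul_eq_mul, mul_zero, zero_add] at hconv
    have : m ≤ a * φ t := hms.trans hconv
    rw [ha] at this
    rw [div_mul_eq_mul_div, div_le_iff₀ hη]
    rw [div_mul_eq_mul_div, le_div_iff₀ htpos] at this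
    linarith
  have hk : 0 ≤ m / η := by positivity
  rcases le_or_gt (|t - 1|) η with h | h
  · have : m / η * (|t - 1| - η) ≤ 0 := mul_nonpos_of_nonneg_of_nonpos hk (by linarith)
    exact this.trans (hφ.nonneg ht)
  · refine (mul_le_mul_of_nonneg_left (by linarith : |t - 1| - η ≤ |t - 1|) hk).trans ?_
    rcases lt_or_ge t 1 with h1 | h1
    · exact key (1 - η) (by linarith [hη1.2]) (by simp [abs_of_pos hη]) h (by nlinarith)
        (min_le_right _ _)
    · have : t ≠ 1 := fun h0 => by simp [h0] at h; linarith
      have : 1 < t := lt_of_le_of_ne h1 this.symm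
      exact key (1 + η) (by linarith) (by simp [abs_of_pos hη]) h (by nlinarith) (min_le_left _ _)

/-- Quadratic approximation of one term of a divergence near the diagonal. -/
lemma term_isLittleO (hφ : IsPhiFunction φ) {c : ℝ} (hc : 0 < c) (hd : HasDerivAt (deriv φ) c 1)
    {a : ℝ} (ha : 0 < a) {α : Type*} {l : Filter α} {x y : α → ℝ} (hx : Tendsto x l (𝓝 a))
    (hy : Tendsto y l (𝓝 a)) :
    (fun i => y i * φ (x i / y i) - c / 2 * ((x i - y i) ^ 2 / a)) =o[l]
      fun i => (x i - y i) ^ 2 := by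
  have hxy : Tendsto (fun i => x i / y i) l (𝓝 1) := by
    have := hx.div hy ha.ne'
    rwa [div_self ha.ne'] at this
  have hy0 : ∀ᶠ i in l, 0 < y i := hy.eventually (lt_mem_nhds ha)
  have h1 := (hφ.peano hc hd).comp_tendsto hxy
  have h2 := (hy.isBigO_one ℝ).mul_isLittleO h1
  have h3 : (fun i => y i * (φ (x i / y i) - c / 2 * (x i / y i - 1) ^ 2)) =o[l]
      fun i => (x i - y i) ^ 2 := by
    refine h2.trans_isBigO ?_
    have h4 : (fun i => (y i)⁻¹ ^ 2) =O[l] fun _ => (1 : ℝ) :=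
      ((hy.inv₀ ha.ne').pow 2).isBigO_one ℝ
    refine ((h4.mul (Asymptotics.isBigO_refl (fun i => (x i - y i) ^ 2) l)).congr' ?_ ?_)
    · filter_upwards [hy0] with i hi
      simp only [Function.comp]; field_simp
    · simp
  -- The expansion at x/y = 1 produces the weight 1/y; this replaces it by the fixed weight 1/a.
  have h5 : (fun i => c / 2 * ((x i - y i) ^ 2 * ((y i)⁻¹ - a⁻¹))) =o[l]
      fun i => (x i - y i) ^ 2 := by
    have : (fun i => (y i)⁻¹ - a⁻¹) =o[l] fun _ => (1 : ℝ) := by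
      rw [Asymptotics.isLittleO_one_iff]
      simpa using (hy.inv₀ ha.ne').sub_const a⁻¹
    simpa using ((Asymptotics.isBigO_refl (fun i => (x i - y i) ^ 2) l).mul_isLittleO
      this).const_mul_left (c / 2)
  refine (h3.add h5).congr' ?_ .rfl
  filter_upwards [hy0] with i hi
  field_simp
  ring

end IsPhiFunction

/-! ### The log-linear model -/

/-- A matrix as a continuous linear map between Euclidean spaces. -/
noncomputable def matrixCLM {a b : ℕ} (A : Matrix (Fin a) (Fin b) ℝ) :
    EuclideanSpace ℝ (Fin b) →L[ℝ] EuclideanSpace ℝ (Fin a) :=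
  (Matrix.toLpLin 2 2 A).toContinuousLinearMap

lemma ofLp_matrixCLM {a b : ℕ} (A : Matrix (Fin a) (Fin b) ℝ) (x : EuclideanSpace ℝ (Fin b)) :
    (matrixCLM A x).ofLp = A.mulVec x.ofLp := rfl

@[simp]
lemma matrixCLM_apply {a b : ℕ} (A : Matrix (Fin a) (Fin b) ℝ) (x : EuclideanSpace ℝ (Fin b))
    (i : Fin a) : matrixCLM A x i = A.mulVec x.ofLp i := rfl

lemma matrixCLM_mul {a b c : ℕ} (A : Matrix (Fin a) (Fin b) ℝ) (B : Matrix (Fin b) (Fin c) ℝ)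
    (x : EuclideanSpace ℝ (Fin c)) : matrixCLM (A * B) x = matrixCLM A (matrixCLM B x) := by
  ext i
  simp [ofLp_matrixCLM, Matrix.mulVec_mulVec]

section LoglinearModel

variable {M M₀ : ℕ} (W : Matrix (Fin M) (Fin M₀) ℝ)

lemma loglinearProb_apply (θ : EuclideanSpace ℝ (Fin M₀)) (r : Fin M) :
    loglinearProb W θ r = Real.exp (W.mulVec θ.ofLp r) / ∑ s, Real.exp (W.mulVec θ.ofLp s) := rfl

lemma loglinearProb_denom_pos (θ : EuclideanSpace ℝ (Fin M₀)) (r : Fin M) :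
    0 < ∑ s, Real.exp (W.mulVec θ.ofLp s) :=
  Finset.sum_pos (fun _ _ => Real.exp_pos _) ⟨r, Finset.mem_univ r⟩

lemma loglinearProb_pos (θ : EuclideanSpace ℝ (Fin M₀)) (r : Fin M) : 0 < loglinearProb W θ r :=
  div_pos (Real.exp_pos _) (loglinearProb_denom_pos W θ r)

lemma sum_loglinearProb [NeZero M] (θ : EuclideanSpace ℝ (Fin M₀)) :
    ∑ r, loglinearProb W θ r = 1 := by
  simp only [loglinearProb_apply, ← Finset.sum_div]
  exact div_self (loglinearProb_denom_pos W θ 0).ne'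

/-- By the quotient rule the derivative in direction h has entries p_r((Wh)_r - ∑ p_s (Wh)_s), which
is Σ applied to Wh. -/
lemma hasFDerivAt_loglinearProb (θ : EuclideanSpace ℝ (Fin M₀)) :
    HasFDerivAt (loglinearProb W) (matrixCLM (multinomialCov (loglinearProb W θ) * W)) θ := by
  rw [← hasFDerivWithinAt_univ, hasFDerivWithinAt_euclidean]
  intro r
  rw [hasFDerivWithinAt_univ]
  have hlin : ∀ s, HasFDerivAt (fun θ : EuclideanSpace ℝ (Fin M₀) => W.mulVec θ.ofLp s)
      (PiLp.proj 2 _ s ∘L matrixCLM W) θ := fun s =>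
    (PiLp.proj 2 (fun _ : Fin M => ℝ) s ∘L matrixCLM W).hasFDerivAt
  have hexp := fun s => (hlin s).exp
  have hsum := HasFDerivAt.fun_sum (u := Finset.univ) fun s _ => hexp s
  have hZ := loglinearProb_denom_pos W θ r
  have hdiv := (hexp r).mul ((hasDerivAt_inv hZ.ne').comp_hasFDerivAt θ hsum)
  have hfun : (fun θ : EuclideanSpace ℝ (Fin M₀) => loglinearProb W θ r) =
      fun θ => Real.exp (W.mulVec θ.ofLp r) * (∑ s, Real.exp (W.mulVec θ.ofLp s))⁻¹ := by
    funext θ; rw [loglinearProb_apply, div_eq_mul_inv]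
  rw [hfun]
  refine hdiv.congr_fderiv ?_
  ext h
  have h1 : ((multinomialCov (loglinearProb W θ) * W).mulVec h.ofLp) r =
      loglinearProb W θ r * W.mulVec h.ofLp r -
        loglinearProb W θ r * ∑ s, loglinearProb W θ s * W.mulVec h.ofLp s := by
    rw [← Matrix.mulVec_mulVec, multinomialCov, Matrix.sub_mulVec, Pi.sub_apply,
      Matrix.mulVec_diagonal, Matrix.vecMulVec_mulVec]
    simp [dotProduct, mul_comm]
  simp only [_root_.add_apply, _root_.smul_apply, smul_eq_mul,
    ContinuousLinearMap.comp_apply, PiLp.proj_apply, matrixCLM_apply, h1,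
    _root_.sum_apply, Function.comp]
  simp only [loglinearProb_apply, div_mul_eq_mul_div, ← Finset.sum_div]
  field_simp
  ring

lemma continuous_loglinearProb : Continuous (loglinearProb W) :=
  continuous_iff_continuousAt.2 fun θ => (hasFDerivAt_loglinearProb W θ).continuousAt

variable {W}

lemma neZero_of_linearIndependent_cons
    (hW : LinearIndependent ℝ
      (Fin.cons (fun _ => 1) (fun j i => W i j) : Fin (M₀ + 1) → Fin M → ℝ)) : NeZero M := by
  refine ⟨fun h => ?_⟩
  subst h
  have := hW.ne_zero 0
  exact this (Subsingleton.elim _ _)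

lemma linearCombination_cons (c : ℝ) (x : Fin M₀ → ℝ) :
    Fintype.linearCombination ℝ
      (Fin.cons (fun _ => 1) (fun j i => W i j) : Fin (M₀ + 1) → Fin M → ℝ) (Fin.cons c x) =
      fun r => c + W.mulVec x r := by
  funext r
  simp [Fintype.linearCombination_apply, Fin.sum_univ_succ, Matrix.mulVec, dotProduct, mul_comm]

/-- The parameter is a smooth function of the logarithms of the probabilities. -/
lemma exists_hasStrictFDerivAt_leftInverse_loglinearProb
    (hW : LinearIndependent ℝ
      (Fin.cons (fun _ => 1) (fun j i => W i j) : Fin (M₀ + 1) → Fin M → ℝ))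
    (θ₀ : EuclideanSpace ℝ (Fin M₀)) :
    ∃ (Ψ : EuclideanSpace ℝ (Fin M) → EuclideanSpace ℝ (Fin M₀))
      (Ψ' : EuclideanSpace ℝ (Fin M) →L[ℝ] EuclideanSpace ℝ (Fin M₀)),
      HasStrictFDerivAt Ψ Ψ' (loglinearProb W θ₀) ∧ ∀ θ, Ψ (loglinearProb W θ) = θ := by
  set G := Fintype.linearCombination ℝ
    (Fin.cons (fun _ => 1) (fun j i => W i j) : Fin (M₀ + 1) → Fin M → ℝ) with hG
  have hker : LinearMap.ker G = ⊥ := LinearMap.ker_eq_bot.2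
    (linearIndependent_iff_injective_fintypeLinearCombination.1 hW)
  obtain ⟨H, hH⟩ := LinearMap.exists_leftInverse_of_injective G hker
  let K : (Fin M → ℝ) →ₗ[ℝ] EuclideanSpace ℝ (Fin M₀) :=
    { toFun := fun y => WithLp.toLp 2 fun j => H y j.succ
      map_add' := fun x y => by ext; simp
      map_smul' := fun c y => by ext; simp }
  have hd : ContDiffAt ℝ 1
      (fun p : EuclideanSpace ℝ (Fin M) => K.toContinuousLinearMap fun r => Real.log (p r))
      (loglinearProb W θ₀) := by
    refine K.toContinuousLinearMap.contDiff.contDiffAt.comp _ ?_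
    rw [contDiffAt_pi]
    intro r
    exact ContDiffAt.log (by fun_prop) (loglinearProb_pos W θ₀ r).ne'
  refine ⟨_, _, hd.hasStrictFDerivAt one_ne_zero, fun θ => ?_⟩
  -- log p(θ) is the image under [1 | W] of the vector (-log Z, θ), Z being the normalizing sum. The
  -- linear left inverse `H` recovers this vector and `K` drops its first coordinate.
  have hlog : (fun r => Real.log (loglinearProb W θ r)) =
      G (Fin.cons (-Real.log (∑ s, Real.exp (W.mulVec θ.ofLp s))) θ.ofLp) := by
    rw [hG, linearCombination_cons]
    funext r
    rw [loglinearProb_apply, Real.log_div (Real.exp_pos _).ne' (loglinearProb_denom_pos W θ r).ne',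
      Real.log_exp]
    ring
  rw [hlog]
  have h1 : ∀ c, H (G c) = c := fun c => LinearMap.congr_fun hH c
  ext j
  simp [K, h1]

lemma mulVec_multinomialCov (p : EuclideanSpace ℝ (Fin M)) (x : Fin M → ℝ) (r : Fin M) :
    (multinomialCov p).mulVec x r = p r * (x r - ∑ s, p s * x s) := by
  rw [multinomialCov, Matrix.sub_mulVec, Pi.sub_apply, Matrix.mulVec_diagonal,
    Matrix.vecMulVec_mulVec]
  simp [dotProduct]
  ring

/-- The quadratic form of Σ_p is the variance of x under the probability vector p. -/
lemma dotProduct_mulVec_multinomialCov {p : EuclideanSpace ℝ (Fin M)} (hp : ∑ r, p r = 1)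
    (x : Fin M → ℝ) :
    x ⬝ᵥ (multinomialCov p).mulVec x = ∑ r, p r * (x r - ∑ s, p s * x s) ^ 2 := by
  set m := ∑ s, p s * x s with hm
  have h1 : ∀ r, x r * (p r * (x r - m)) =
      p r * (x r - m) ^ 2 + m * (p r * x r) - m * m * p r := fun r => by ring
  simp only [dotProduct, mulVec_multinomialCov, ← hm, h1, Finset.sum_sub_distrib,
    Finset.sum_add_distrib, ← Finset.mul_sum, hp]
  ring

lemma multinomialCov_isSymm (p : EuclideanSpace ℝ (Fin M)) : (multinomialCov p).IsSymm := by
  rw [multinomialCov, Matrix.IsSymm, Matrix.transpose_sub, Matrix.diagonal_transpose,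
    Matrix.transpose_vecMulVec]

lemma posSemidef_multinomialCov {p : EuclideanSpace ℝ (Fin M)} (h0 : ∀ r, 0 ≤ p r)
    (hp : ∑ r, p r = 1) : (multinomialCov p).PosSemidef := by
  refine Matrix.PosSemidef.of_dotProduct_mulVec_nonneg ?_ fun x => ?_
  · rw [Matrix.IsHermitian, Matrix.conjTranspose_eq_transpose_of_trivial, multinomialCov_isSymm]
  · rw [star_trivial, dotProduct_mulVec_multinomialCov hp]
    exact Finset.sum_nonneg fun r _ => mul_nonneg (h0 r) (sq_nonneg _)

/-- The Fisher information matrix of the log-linear model is positive definite. -/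
lemma posDef_transpose_mul_multinomialCov_mul
    (hW : LinearIndependent ℝ
      (Fin.cons (fun _ => 1) (fun j i => W i j) : Fin (M₀ + 1) → Fin M → ℝ))
    {p : EuclideanSpace ℝ (Fin M)} (h0 : ∀ r, 0 < p r) (hp : ∑ r, p r = 1) :
    (W.transpose * multinomialCov p * W).PosDef := by
  have hsd := (posSemidef_multinomialCov (fun r => (h0 r).le) hp).conjTranspose_mul_mul_same W
  rw [Matrix.conjTranspose_eq_transpose_of_trivial] at hsd
  refine Matrix.PosDef.of_dotProduct_mulVec_pos hsd.isHermitian fun x hx => ?_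
  have heq : star x ⬝ᵥ (W.transpose * multinomialCov p * W).mulVec x =
      ∑ r, p r * (W.mulVec x r - ∑ s, p s * W.mulVec x s) ^ 2 := by
    rw [← dotProduct_mulVec_multinomialCov hp, star_trivial, ← Matrix.mulVec_mulVec,
      ← Matrix.mulVec_mulVec, Matrix.dotProduct_mulVec, Matrix.vecMul_transpose]
  rw [heq]
  have hnn : ∀ r ∈ Finset.univ, 0 ≤ p r * (W.mulVec x r - ∑ s, p s * W.mulVec x s) ^ 2 :=
    fun r _ => mul_nonneg (h0 r).le (sq_nonneg _)
  refine lt_of_le_of_ne (Finset.sum_nonneg hnn) fun h => hx ?_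
  rw [eq_comm, Finset.sum_eq_zero_iff_of_nonneg hnn] at h
  -- If Wx has variance 0 under a positive p, it is constant, which is a linear relation between the
  -- columns of W and the all-ones vector.
  have hz : Fintype.linearCombination ℝ
      (Fin.cons (fun _ => 1) (fun j i => W i j) : Fin (M₀ + 1) → Fin M → ℝ)
      (Fin.cons (-∑ s, p s * W.mulVec x s) x) = 0 := by
    rw [linearCombination_cons]
    funext r
    have := h r (Finset.mem_univ r)
    have := pow_eq_zero_iff (two_ne_zero) |>.1 ((mul_eq_zero.1 this).resolve_left (h0 r).ne')
    simp only [Pi.zero_apply]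
    linarith
  have h1 := linearIndependent_iff_injective_fintypeLinearCombination.1 hW (hz.trans (map_zero _).symm)
  funext j
  simpa using congrFun h1 j.succ

end LoglinearModel

/-! ### Divergences of positive vectors -/

lemma EuclideanSpace.norm_le_sum_abs {M : ℕ} (x : EuclideanSpace ℝ (Fin M)) :
    ‖x‖ ≤ ∑ r, |x r| := by
  rw [EuclideanSpace.norm_eq]
  refine Real.sqrt_le_iff.2 ⟨Finset.sum_nonneg fun _ _ => abs_nonneg _, ?_⟩
  exact Finset.sum_sq_le_sq_sum_of_nonneg fun _ _ => norm_nonneg _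

lemma tendsto_euclideanSpace_apply {M : ℕ} {α : Type*} {l : Filter α}
    {x : α → EuclideanSpace ℝ (Fin M)} {a : EuclideanSpace ℝ (Fin M)} (h : Tendsto x l (𝓝 a))
    (r : Fin M) : Tendsto (fun i => x i r) l (𝓝 (a r)) :=
  ((PiLp.continuous_apply 2 (fun _ : Fin M => ℝ) r).tendsto a).comp h

lemma eventually_euclideanSpace_pos {M : ℕ} {a : EuclideanSpace ℝ (Fin M)} (ha : ∀ r, 0 < a r) :
    ∀ᶠ q in 𝓝 a, ∀ r, 0 < q r :=
  eventually_all.2 fun r => (tendsto_euclideanSpace_apply tendsto_id r).eventually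
    (lt_mem_nhds (ha r))

/-- The bilinear form `∑ r, x_r y_r / w_r`. -/
noncomputable def weightedInner {M : ℕ} (w x y : EuclideanSpace ℝ (Fin M)) : ℝ :=
  ∑ r, x r * y r / w r

section WeightedInner

variable {M : ℕ} {w : EuclideanSpace ℝ (Fin M)}

lemma weightedInner_add_left (x y z : EuclideanSpace ℝ (Fin M)) :
    weightedInner w (x + y) z = weightedInner w x z + weightedInner w y z := by
  simp [weightedInner, add_mul, add_div, Finset.sum_add_distrib]

lemma weightedInner_comm (x y : EuclideanSpace ℝ (Fin M)) :
    weightedInner w x y = weightedInner w y x := by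
  simp [weightedInner, mul_comm]

lemma weightedInner_add_right (x y z : EuclideanSpace ℝ (Fin M)) :
    weightedInner w x (y + z) = weightedInner w x y + weightedInner w x z := by
  rw [weightedInner_comm, weightedInner_add_left, weightedInner_comm y, weightedInner_comm z]

lemma weightedInner_add_self (x y : EuclideanSpace ℝ (Fin M)) :
    weightedInner w (x + y) (x + y) =
      weightedInner w x x + 2 * weightedInner w x y + weightedInner w y y := by
  rw [weightedInner_add_left, weightedInner_add_right, weightedInner_add_right,
    weightedInner_comm y x]
  ring

lemma sq_norm_le_weightedInner_self (h0 : ∀ r, 0 < w r) (h1 : ∑ r, w r = 1)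
    (x : EuclideanSpace ℝ (Fin M)) : ‖x‖ ^ 2 ≤ weightedInner w x x := by
  rw [EuclideanSpace.norm_sq_eq, weightedInner]
  refine Finset.sum_le_sum fun r _ => ?_
  have hr : w r ≤ 1 := h1 ▸ Finset.single_le_sum (fun s _ => (h0 s).le) (Finset.mem_univ r)
  rw [Real.norm_eq_abs, sq_abs, le_div_iff₀ (h0 r)]
  nlinarith [sq_nonneg (x r)]

lemma abs_weightedInner_le (x y : EuclideanSpace ℝ (Fin M)) :
    |weightedInner w x y| ≤ (∑ r, |(w r)⁻¹|) * (‖x‖ * ‖y‖) := by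
  rw [weightedInner, Finset.sum_mul]
  refine (Finset.abs_sum_le_sum_abs _ _).trans (Finset.sum_le_sum fun r _ => ?_)
  rw [div_eq_mul_inv, abs_mul, abs_mul, mul_comm]
  have hx := PiLp.norm_apply_le x r
  have hy := PiLp.norm_apply_le y r
  rw [Real.norm_eq_abs] at hx hy
  gcongr

lemma weightedInner_isBigO {α : Type*} {l : Filter α} (x y : α → EuclideanSpace ℝ (Fin M)) :
    (fun i => weightedInner w (x i) (y i)) =O[l] fun i => ‖x i‖ * ‖y i‖ :=
  .of_bound (∑ r, |(w r)⁻¹|) <| Eventually.of_forall fun i => by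
    rw [Real.norm_eq_abs, Real.norm_of_nonneg (by positivity)]
    exact abs_weightedInner_le _ _

end WeightedInner

/-- The divergence `∑ r, p_r φ(q_r / p_r)` of vectors with positive entries. -/
noncomputable def realPhiDivergence {M : ℕ} (φ : ℝ → ℝ) (q p : EuclideanSpace ℝ (Fin M)) : ℝ :=
  ∑ r, p r * φ (q r / p r)

/-- With positive entries the conventions for empty cells play no role. This suffices for the
asymptotics, since q near p(θ₀) has positive entries. -/
lemma phiDivergence_eq_coe {M : ℕ} (φ : ℝ → ℝ) {q p : EuclideanSpace ℝ (Fin M)}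
    (hq : ∀ r, 0 < q r) (hp : ∀ r, 0 < p r) :
    phiDivergence φ q p = (realPhiDivergence φ q p : EReal) := by
  let f : ℝ →+ EReal := ⟨⟨Real.toEReal, EReal.coe_zero⟩, EReal.coe_add⟩
  have h : (realPhiDivergence φ q p : EReal) = f (∑ r, p r * φ (q r / p r)) := rfl
  rw [h, map_sum, phiDivergence]
  refine Finset.sum_congr rfl fun r _ => ?_
  rw [phiTerm, if_neg (hp r).ne', if_neg (hq r).ne']
  rfl

namespace IsPhiFunction

variable {φ : ℝ → ℝ} {M : ℕ}

/-- Both arguments may vary while the weight stays frozen at their common limit, so that divergences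
at different model points are compared through one quadratic form. -/
lemma realPhiDivergence_sub_isLittleO (hφ : IsPhiFunction φ) {c : ℝ} (hc : 0 < c)
    (hd : HasDerivAt (deriv φ) c 1) {w : EuclideanSpace ℝ (Fin M)} (hw : ∀ r, 0 < w r)
    {α : Type*} {l : Filter α} {q p : α → EuclideanSpace ℝ (Fin M)} (hq : Tendsto q l (𝓝 w))
    (hp : Tendsto p l (𝓝 w)) :
    (fun i => realPhiDivergence φ (q i) (p i) -
      c / 2 * weightedInner w (q i - p i) (q i - p i)) =o[l] fun i => ‖q i - p i‖ ^ 2 := by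
  have hterm : ∀ r ∈ Finset.univ, (fun i => p i r * φ (q i r / p i r) -
      c / 2 * ((q i r - p i r) ^ 2 / w r)) =o[l] fun i => ‖q i - p i‖ ^ 2 := by
    intro r _
    refine (hφ.term_isLittleO hc hd (hw r) (tendsto_euclideanSpace_apply hq r)
      (tendsto_euclideanSpace_apply hp r)).trans_isBigO ?_
    refine .of_bound 1 (Eventually.of_forall fun i => ?_)
    rw [norm_pow, norm_pow, norm_norm, one_mul]
    exact pow_le_pow_left₀ (norm_nonneg _) (PiLp.norm_apply_le (q i - p i) r) 2
  refine (Asymptotics.IsLittleO.sum hterm).congr_left fun i => ?_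
  rw [Finset.sum_apply, Finset.sum_sub_distrib, ← Finset.mul_sum, realPhiDivergence, weightedInner]
  simp only [PiLp.sub_apply, pow_two]

lemma tendsto_realPhiDivergence_self (hφ : IsPhiFunction φ) {w : EuclideanSpace ℝ (Fin M)}
    (hw : ∀ r, 0 < w r) : Tendsto (fun q => realPhiDivergence φ q w) (𝓝 w) (𝓝 0) := by
  have : Tendsto (fun q : EuclideanSpace ℝ (Fin M) => ∑ r, w r * φ (q r / w r)) (𝓝 w)
      (𝓝 (∑ r, w r * φ 1)) := by
    refine tendsto_finsetSum _ fun r _ => Tendsto.const_mul _ ?_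
    refine hφ.hasDerivAt_one.continuousAt.tendsto.comp ?_
    have := (tendsto_euclideanSpace_apply (tendsto_id (x := 𝓝 w)) r).div_const (w r)
    rwa [div_self (hw r).ne'] at this
  simp only [hφ.map_one, mul_zero, Finset.sum_const_zero] at this
  exact this

/-- Divergences are bounded away from `0` away from the diagonal. -/
lemma exists_le_realPhiDivergence (hφ : IsPhiFunction φ) {w : EuclideanSpace ℝ (Fin M)}
    (hw : ∀ r, 0 < w r) {ε : ℝ} (hε : 0 < ε) :
    ∃ m > 0, ∀ᶠ q in 𝓝 w, ∀ p : EuclideanSpace ℝ (Fin M), (∀ r, 0 < p r) → ∑ r, p r = 1 →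
      ε ≤ ‖p - w‖ → m ≤ realPhiDivergence φ q p := by
  -- Budget: ‖p - w‖ ≥ ε and ‖q - w‖ < ε/2 leave ‖q - p‖ > ε/2, and η < ε/4 still leaves ε/4.
  obtain ⟨η, ⟨k, hk, hlin⟩, hη⟩ := (hφ.eventually_exists_linear_le.and
    (Ioo_mem_nhdsGT (show (0 : ℝ) < ε / 4 by positivity))).exists
  refine ⟨k * (ε / 4), by positivity, ?_⟩
  filter_upwards [Metric.ball_mem_nhds w (half_pos hε), eventually_euclideanSpace_pos hw]
    with q hq hq0 p hp0 hp1 hp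
  rw [mem_ball_iff_norm] at hq
  have hterm : ∀ r, k * (|(q - p) r| - η * p r) ≤ p r * φ (q r / p r) := by
    intro r
    have := mul_le_mul_of_nonneg_left (hlin _ (div_pos (hq0 r) (hp0 r))) (hp0 r).le
    refine le_trans (le_of_eq ?_) this
    have h1 : (q - p) r = p r * (q r / p r - 1) := by
      rw [PiLp.sub_apply]; field_simp [(hp0 r).ne']
    rw [h1, abs_mul, abs_of_pos (hp0 r)]
    ring
  have hsum : k * (∑ r, |(q - p) r| - η) ≤ realPhiDivergence φ q p := by
    refine le_trans (le_of_eq ?_) (Finset.sum_le_sum fun r _ => hterm r)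
    rw [← Finset.mul_sum, Finset.sum_sub_distrib, ← Finset.mul_sum, hp1, mul_one]
  refine le_trans (mul_le_mul_of_nonneg_left ?_ hk.le) hsum
  have h1 := EuclideanSpace.norm_le_sum_abs (q - p)
  have h2 : ‖p - w‖ ≤ ‖q - w‖ + ‖q - p‖ := by
    have := norm_sub_le (q - w) (q - p)
    rwa [sub_sub_sub_cancel_left] at this
  linarith [hη.2]

end IsPhiFunction

/-! ### Minimum divergence estimation as a deterministic problem -/

section MinDivergence

variable {φ : ℝ → ℝ} {M M₀ : ℕ} {W : Matrix (Fin M) (Fin M₀) ℝ}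
  {Θ : Set (EuclideanSpace ℝ (Fin M₀))} {θ₀ : EuclideanSpace ℝ (Fin M₀)}

lemma isMinPhiDivergence_iff {q : EuclideanSpace ℝ (Fin M)} (hq : ∀ r, 0 < q r)
    {t : EuclideanSpace ℝ (Fin M₀)} :
    IsMinPhiDivergence φ W Θ q t ↔ t ∈ Θ ∧ ∀ θ ∈ Θ,
      realPhiDivergence φ q (loglinearProb W t) ≤ realPhiDivergence φ q (loglinearProb W θ) := by
  simp only [IsMinPhiDivergence, IsMinOn, IsMinFilter, eventually_principal,
    phiDivergence_eq_coe φ hq (loglinearProb_pos W _), EReal.coe_le_coe_iff]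

/-- Parameters that fit `q` at least as well as `θ₀` are close to `θ₀`. -/
lemma eventually_forall_norm_loglinearProb_sub_lt [NeZero M] (hφ : IsPhiFunction φ) {ε : ℝ}
    (hε : 0 < ε) :
    ∀ᶠ q in 𝓝 (loglinearProb W θ₀), ∀ θ, realPhiDivergence φ q (loglinearProb W θ) ≤
      realPhiDivergence φ q (loglinearProb W θ₀) →
      ‖loglinearProb W θ - loglinearProb W θ₀‖ < ε := by
  obtain ⟨m, hm, h⟩ := hφ.exists_le_realPhiDivergence (loglinearProb_pos W θ₀) hε
  filter_upwards [h, (hφ.tendsto_realPhiDivergence_self (loglinearProb_pos W θ₀)).eventually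
    (gt_mem_nhds hm)] with q h1 h2 θ h3
  by_contra! h4
  linarith [h1 _ (loglinearProb_pos W θ) (sum_loglinearProb W θ) h4]

lemma continuous_realPhiDivergence_loglinearProb (hφ : IsPhiFunction φ)
    {q : EuclideanSpace ℝ (Fin M)} (hq : ∀ r, 0 < q r) :
    Continuous fun θ => realPhiDivergence φ q (loglinearProb W θ) := by
  refine continuous_finsetSum _ fun r _ => ?_
  have hr : Continuous fun θ => loglinearProb W θ r :=
    (PiLp.continuous_apply 2 (fun _ : Fin M => ℝ) r).comp (continuous_loglinearProb W)
  refine hr.mul (hφ.continuousOn.comp_continuous ?_ fun θ => ?_)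
  · exact continuous_const.div hr fun θ => (loglinearProb_pos W θ r).ne'
  · exact div_pos (hq r) (loglinearProb_pos W θ r)

/-- Minimum divergence estimates exist near the model point. -/
lemma eventually_exists_isMinPhiDivergence
    (hW : LinearIndependent ℝ
      (Fin.cons (fun _ => 1) (fun j i => W i j) : Fin (M₀ + 1) → Fin M → ℝ))
    (hφ : IsPhiFunction φ) (hθ₀ : θ₀ ∈ interior Θ) :
    ∀ᶠ q in 𝓝 (loglinearProb W θ₀), ∃ t, IsMinPhiDivergence φ W Θ q t := by
  have := neZero_of_linearIndependent_cons hW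
  obtain ⟨Ψ, Ψ', hΨ, hinv⟩ := exists_hasStrictFDerivAt_leftInverse_loglinearProb hW θ₀
  obtain ⟨R, hR, hball⟩ := Metric.nhds_basis_closedBall.mem_iff.1 (mem_interior_iff_mem_nhds.1 hθ₀)
  have hcont : Tendsto Ψ (𝓝 (loglinearProb W θ₀)) (𝓝 θ₀) := by
    have := hΨ.continuousAt.tendsto
    rwa [hinv] at this
  obtain ⟨ε, hε, hsub⟩ := Metric.eventually_nhds_iff_ball.1
    (hcont.eventually (Metric.closedBall_mem_nhds θ₀ hR))
  filter_upwards [eventually_forall_norm_loglinearProb_sub_lt (W := W) (θ₀ := θ₀) hφ hε,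
    eventually_euclideanSpace_pos (loglinearProb_pos W θ₀)] with q hclose hq
  -- A minimizer over a closed ball inside Θ is global: a competitor at least as good as θ₀ has p(θ)
  -- near p(θ₀), so θ = Ψ(p(θ)) lies in the ball.
  obtain ⟨t, ht, hmin⟩ := (isCompact_closedBall θ₀ R).exists_isMinOn
    ⟨θ₀, Metric.mem_closedBall_self hR.le⟩
    (continuous_realPhiDivergence_loglinearProb (W := W) hφ hq).continuousOn
  refine ⟨t, (isMinPhiDivergence_iff hq).2 ⟨hball ht, fun θ _ => ?_⟩⟩
  by_cases h : realPhiDivergence φ q (loglinearProb W θ) ≤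
      realPhiDivergence φ q (loglinearProb W θ₀)
  · refine hmin (?_ : θ ∈ Metric.closedBall θ₀ R)
    have := hsub (loglinearProb W θ) (mem_ball_iff_norm.2 (hclose θ h))
    rwa [hinv] at this
  · exact (hmin (Metric.mem_closedBall_self hR.le)).trans (not_le.1 h).le

lemma sum_multinomialCov_mulVec {p : EuclideanSpace ℝ (Fin M)} (hp : ∑ r, p r = 1)
    (x : Fin M → ℝ) : ∑ r, (multinomialCov p).mulVec x r = 0 := by
  simp only [mulVec_multinomialCov, mul_sub, Finset.sum_sub_distrib, ← Finset.sum_mul, hp]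
  ring

/-- Normal equations of the weighted least squares problem. -/
lemma weightedInner_residual_eq_zero {p : EuclideanSpace ℝ (Fin M)} (h0 : ∀ r, 0 < p r)
    (h1 : ∑ r, p r = 1) (hdet : IsUnit (W.transpose * multinomialCov p * W).det)
    {e : EuclideanSpace ℝ (Fin M)} (he : ∑ r, e r = 0) (k : EuclideanSpace ℝ (Fin M₀)) :
    weightedInner p (e - matrixCLM (multinomialCov p * W)
      (matrixCLM ((W.transpose * multinomialCov p * W)⁻¹ * W.transpose) e))
      (matrixCLM (multinomialCov p * W) k) = 0 := by
  set x := e - matrixCLM (multinomialCov p * W)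
      (matrixCLM ((W.transpose * multinomialCov p * W)⁻¹ * W.transpose) e) with hx
  have hxsum : ∑ r, x r = 0 := by
    simp only [hx, PiLp.sub_apply, Finset.sum_sub_distrib, he, matrixCLM_apply,
      ← Matrix.mulVec_mulVec, sum_multinomialCov_mulVec h1, sub_zero]
  have hxW : W.transpose.mulVec x.ofLp = 0 := by
    rw [hx, WithLp.ofLp_sub, ofLp_matrixCLM, ofLp_matrixCLM, Matrix.mulVec_sub,
      Matrix.mulVec_mulVec, Matrix.mulVec_mulVec, ← Matrix.mul_assoc, ← Matrix.mul_assoc,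
      Matrix.mul_nonsing_inv _ hdet, Matrix.one_mul, sub_self]
  -- Division by p_r turns ΣWk into Wk minus its mean under p; the mean contributes nothing because
  -- x sums to 0.
  have hterm : ∀ r, x r * matrixCLM (multinomialCov p * W) k r / p r =
      x r * W.mulVec k.ofLp r - (∑ s, p s * W.mulVec k.ofLp s) * x r := by
    intro r
    rw [matrixCLM_apply, ← Matrix.mulVec_mulVec, mulVec_multinomialCov]
    field_simp [(h0 r).ne']
  have hdot : ∑ r, x r * W.mulVec k.ofLp r = 0 := by
    change x.ofLp ⬝ᵥ W.mulVec k.ofLp = 0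
    rw [Matrix.dotProduct_mulVec, ← Matrix.mulVec_transpose, hxW, zero_dotProduct]
  rw [weightedInner]
  simp only [hterm, Finset.sum_sub_distrib, ← Finset.mul_sum, hdot, hxsum]
  simp

/-- Linearization of minimum divergence estimates. -/
theorem isLittleO_of_isMinPhiDivergence
    (hW : LinearIndependent ℝ
      (Fin.cons (fun _ => 1) (fun j i => W i j) : Fin (M₀ + 1) → Fin M → ℝ))
    (hφ : IsPhiFunction φ) (hθ₀ : θ₀ ∈ interior Θ) {α : Type*} {l : Filter α}
    {q : α → EuclideanSpace ℝ (Fin M)} {t : α → EuclideanSpace ℝ (Fin M₀)}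
    (hq : Tendsto q l (𝓝 (loglinearProb W θ₀))) (hsum : ∀ᶠ i in l, ∑ r, q i r = 1)
    (ht : ∀ᶠ i in l, IsMinPhiDivergence φ W Θ (q i) (t i)) :
    (fun i => t i - θ₀ -
      matrixCLM ((W.transpose * multinomialCov (loglinearProb W θ₀) * W)⁻¹ * W.transpose)
        (q i - loglinearProb W θ₀)) =o[l] fun i => q i - loglinearProb W θ₀ := by
  have := neZero_of_linearIndependent_cons hW
  obtain ⟨Ψ, Ψ', hΨ, hinv⟩ := exists_hasStrictFDerivAt_leftInverse_loglinearProb hW θ₀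
  obtain ⟨c, hc, hd⟩ := hφ.second_deriv_pos
  set p := loglinearProb W with hp
  set w := p θ₀ with hw
  have hw0 : ∀ r, 0 < w r := loglinearProb_pos W θ₀
  have hw1 : ∑ r, w r = 1 := sum_loglinearProb W θ₀
  have hdet : IsUnit (W.transpose * multinomialCov w * W).det :=
    (Matrix.isUnit_iff_isUnit_det _).1 (posDef_transpose_mul_multinomialCov_mul hW hw0 hw1).isUnit
  set J := matrixCLM (multinomialCov w * W) with hJ
  set A := matrixCLM ((W.transpose * multinomialCov w * W)⁻¹ * W.transpose) with hA
  set e := fun i => q i - w with he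
  have hwΨ : Ψ w = θ₀ := hinv θ₀
  have hpJ : HasFDerivAt p J θ₀ := hasFDerivAt_loglinearProb W θ₀
  have he0 : Tendsto e l (𝓝 0) := by simpa using hq.sub_const w
  have hq0 : ∀ᶠ i in l, ∀ r, 0 < q i r := hq.eventually (eventually_euclideanSpace_pos hw0)
  have hmin : ∀ᶠ i in l, ∀ θ ∈ Θ,
      realPhiDivergence φ (q i) (p (t i)) ≤ realPhiDivergence φ (q i) (p θ) := by
    filter_upwards [ht, hq0] with i h1 h2 using ((isMinPhiDivergence_iff h2).1 h1).2
  have hmin0 : ∀ᶠ i in l,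
      realPhiDivergence φ (q i) (p (t i)) ≤ realPhiDivergence φ (q i) w := by
    filter_upwards [hmin] with i h using h _ (interior_subset hθ₀)
  have hpt : Tendsto (fun i => p (t i)) l (𝓝 w) := by
    rw [Metric.tendsto_nhds]
    intro ε hε
    filter_upwards [hmin0, hq.eventually
      (eventually_forall_norm_loglinearProb_sub_lt (W := W) (θ₀ := θ₀) hφ hε)] with i h1 h2
    rw [dist_eq_norm]
    exact h2 _ h1
  have htΨ : Tendsto t l (𝓝 θ₀) := by
    have := hΨ.continuousAt.tendsto.comp hpt
    simpa only [Function.comp_def, hinv, hwΨ] using this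
  -- rate of convergence
  have happrox := hφ.realPhiDivergence_sub_isLittleO hc hd hw0 hq hpt
  have happrox0 := hφ.realPhiDivergence_sub_isLittleO hc hd hw0 hq tendsto_const_nhds
  have hDw : (fun i => realPhiDivergence φ (q i) w) =O[l] fun i => ‖e i‖ ^ 2 := by
    have h1 : (fun i => c / 2 * weightedInner w (e i) (e i)) =O[l] fun i => ‖e i‖ ^ 2 := by
      simpa only [pow_two] using (weightedInner_isBigO e e).const_mul_left (c / 2)
    exact (happrox0.isBigO.add h1).congr_left fun i => by simp only [he]; ring
  -- At the minimizer the divergence is at most its value at w, hence O(‖e‖²), and it is at least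
  -- (c/2 - c/4)‖q - p(t)‖².
  have hqp : (fun i => q i - p (t i)) =O[l] e := by
    obtain ⟨C, hC, hDC⟩ := hDw.exists_pos
    refine .of_bound (√(4 / c * C)) ?_
    filter_upwards [happrox.def (c := c / 4) (by positivity), hDC.bound, hmin0] with i h1 h2 h3
    have h4 := sq_norm_le_weightedInner_self hw0 hw1 (q i - p (t i))
    rw [norm_pow, norm_norm] at h1 h2
    rw [Real.norm_eq_abs] at h1 h2
    have h5 : c / 4 * ‖q i - p (t i)‖ ^ 2 ≤ C * ‖e i‖ ^ 2 := by
      have := (abs_le.1 h1).1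
      have := le_of_abs_le h2
      nlinarith
    refine (pow_le_pow_iff_left₀ (norm_nonneg _) (by positivity) two_ne_zero).1 ?_
    rw [mul_pow, Real.sq_sqrt (by positivity)]
    calc ‖q i - p (t i)‖ ^ 2 = 4 / c * (c / 4 * ‖q i - p (t i)‖ ^ 2) := by field_simp
      _ ≤ 4 / c * (C * ‖e i‖ ^ 2) := mul_le_mul_of_nonneg_left h5 (by positivity)
      _ = _ := by ring
  have hptO : (fun i => p (t i) - w) =O[l] e := by
    refine ((Asymptotics.isBigO_refl e l).sub hqp).congr_left fun i => ?_
    simp [he]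
  have htO : (fun i => t i - θ₀) =O[l] e := by
    have := (hΨ.hasFDerivAt.isBigO_sub.comp_tendsto hpt).trans hptO
    simpa only [Function.comp_def, hwΨ, hinv] using this
  -- the linearized solution
  set s := fun i => θ₀ + A (e i) with hs
  have hs0 : Tendsto s l (𝓝 θ₀) := by
    have := ((A.continuous.tendsto 0).comp he0).const_add θ₀
    simpa [hs] using this
  have hsΘ : ∀ᶠ i in l, s i ∈ Θ := hs0.eventually (mem_interior_iff_mem_nhds.1 hθ₀)
  have hAe : (fun i => A (e i)) =O[l] e := A.isBigO_comp e l
  have hps : Tendsto (fun i => p (s i)) l (𝓝 w) := hpJ.continuousAt.tendsto.comp hs0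
  have hpsJ : (fun i => p (s i) - w - J (A (e i))) =o[l] e := by
    have := (hpJ.isLittleO.comp_tendsto hs0)
    simp only [Function.comp_def, hs, add_sub_cancel_left] at this
    exact this.trans_isBigO hAe
  have hptJ : (fun i => p (t i) - w - J (t i - θ₀)) =o[l] e :=
    (hpJ.isLittleO.comp_tendsto htΨ).trans_isBigO htO
  have hpsO : (fun i => p (s i) - w) =O[l] e := by
    have := hpsJ.isBigO.add ((J.isBigO_comp _ l).trans hAe)
    simpa using this
  set u := fun i => q i - p (s i) with hu
  set v := fun i => p (s i) - p (t i) with hv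
  have huO : u =O[l] e := by
    refine ((Asymptotics.isBigO_refl e l).sub hpsO).congr_left fun i => ?_
    simp [he, hu]
  have hvO : v =O[l] e := (hpsO.sub hptO).congr_left fun i => by simp [hv]
  -- To first order `u` is the least squares residual and `v` a tangent vector J(·), and these are
  -- orthogonal in the weighted inner product. The errors `u₁` and `v₁` are paired with O(‖e‖)
  -- factors.
  have hcross : (fun i => weightedInner w (u i) (v i)) =o[l] fun i => ‖e i‖ ^ 2 := by
    set u₀ := fun i => e i - J (A (e i)) with hu₀
    set u₁ := fun i => u i - u₀ i with hu₁
    set v₁ := fun i => v i - J (A (e i) - (t i - θ₀)) with hv₁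
    have hu₀O : u₀ =O[l] e := (Asymptotics.isBigO_refl e l).sub ((J.isBigO_comp _ l).trans hAe)
    have hu₁o : u₁ =o[l] e := by
      refine hpsJ.neg_left.congr_left fun i => ?_
      simp only [hu₁, hu₀, hu, he]; abel
    have hv₁o : v₁ =o[l] e := by
      refine (hpsJ.sub hptJ).congr_left fun i => ?_
      simp only [hv₁, hv, map_sub]; abel
    have h1 : (fun i => weightedInner w (u₁ i) (v i)) =o[l] fun i => ‖e i‖ ^ 2 := by
      simp only [pow_two]
      exact (weightedInner_isBigO u₁ v).trans_isLittleO (hu₁o.norm_norm.mul_isBigO hvO.norm_norm)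
    have h2 : (fun i => weightedInner w (u₀ i) (v₁ i)) =o[l] fun i => ‖e i‖ ^ 2 := by
      simp only [pow_two]
      exact (weightedInner_isBigO u₀ v₁).trans_isLittleO (hu₀O.norm_norm.mul_isLittleO hv₁o.norm_norm)
    refine (h1.add h2).congr' ?_ .rfl
    filter_upwards [hsum] with i hi
    have hei : ∑ r, e i r = 0 := by
      simp only [he, PiLp.sub_apply, Finset.sum_sub_distrib, hi, hw1, sub_self]
    have hz : weightedInner w (u₀ i) (J (A (e i) - (t i - θ₀))) = 0 :=
      weightedInner_residual_eq_zero hw0 hw1 hdet hei _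
    have h3 : weightedInner w (u₀ i) (v i) = weightedInner w (u₀ i) (v₁ i) := by
      rw [show v i = v₁ i + J (A (e i) - (t i - θ₀)) by simp [hv₁], weightedInner_add_right, hz,
        add_zero]
    rw [← h3, ← weightedInner_add_left]
    simp [hu₁]
  have happrox' : (fun i => realPhiDivergence φ (q i) (p (t i)) -
      c / 2 * weightedInner w (u i + v i) (u i + v i)) =o[l] fun i => ‖e i‖ ^ 2 := by
    have := happrox.trans_isBigO (hqp.norm_norm.pow 2)
    refine this.congr_left fun i => ?_
    rw [show u i + v i = q i - p (t i) by simp [hu, hv]]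
  have happroxs : (fun i => realPhiDivergence φ (q i) (p (s i)) -
      c / 2 * weightedInner w (u i) (u i)) =o[l] fun i => ‖e i‖ ^ 2 :=
    (hφ.realPhiDivergence_sub_isLittleO hc hd hw0 hq hps).trans_isBigO (huO.norm_norm.pow 2)
  have hvo : v =o[l] e := by
    rw [Asymptotics.isLittleO_iff]
    intro ε hε
    -- Two expansion errors of (c/8)ε²‖e‖² contribute ε²/2 after division by c/2, and twice the
    -- cross term contributes the other ε²/2.
    have hδ : 0 < c / 8 * ε ^ 2 := by positivity
    filter_upwards [happrox'.def hδ, happroxs.def hδ, hcross.def (c := ε ^ 2 / 4) (by positivity),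
      hmin, hsΘ] with i h1 h2 h3 h4 h5
    rw [norm_pow, norm_norm, Real.norm_eq_abs] at h1 h2 h3
    have h6 := h4 _ h5
    have h7 := sq_norm_le_weightedInner_self hw0 hw1 (v i)
    rw [weightedInner_add_self] at h1
    refine (pow_le_pow_iff_left₀ (norm_nonneg _) (by positivity) two_ne_zero).1 ?_
    rw [mul_pow]
    have h8 := (abs_le.1 h1).1
    have h9 := (abs_le.1 h2).2
    have h10 := (abs_le.1 h3).1
    have h11 : c / 2 * (2 * weightedInner w (u i) (v i) + weightedInner w (v i) (v i)) ≤
        c / 2 * (ε ^ 2 / 2 * ‖e i‖ ^ 2) := by nlinarith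
    have h12 := le_of_mul_le_mul_left h11 (by positivity)
    nlinarith
  -- Strict differentiability makes Ψ Lipschitz near w, as required for a pair of moving points.
  have hfinal : (fun i => t i - s i) =O[l] v := by
    have h1 : Tendsto (fun i => (p (t i), p (s i))) l (𝓝 (w, w)) := hpt.prodMk_nhds hps
    have h2 := hΨ.isBigO_sub.comp_tendsto h1
    simp only [Function.comp_def, hinv] at h2
    refine h2.trans ?_
    rw [← Asymptotics.isBigO_neg_right]
    simp only [hv, neg_sub]
    exact Asymptotics.isBigO_refl _ _
  refine (hfinal.trans_isLittleO hvo).congr_left fun i => ?_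
  simp only [hs]; abel

/-- Linearization of the probabilities fitted by minimum divergence. -/
theorem isLittleO_loglinearProb_of_isMinPhiDivergence
    (hW : LinearIndependent ℝ
      (Fin.cons (fun _ => 1) (fun j i => W i j) : Fin (M₀ + 1) → Fin M → ℝ))
    (hφ : IsPhiFunction φ) (hθ₀ : θ₀ ∈ interior Θ) {α : Type*} {l : Filter α}
    {q : α → EuclideanSpace ℝ (Fin M)} {t : α → EuclideanSpace ℝ (Fin M₀)}
    (hq : Tendsto q l (𝓝 (loglinearProb W θ₀))) (hsum : ∀ᶠ i in l, ∑ r, q i r = 1)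
    (ht : ∀ᶠ i in l, IsMinPhiDivergence φ W Θ (q i) (t i)) :
    (fun i => loglinearProb W (t i) - loglinearProb W θ₀ -
      matrixCLM (multinomialCov (loglinearProb W θ₀) * W *
        ((W.transpose * multinomialCov (loglinearProb W θ₀) * W)⁻¹ * W.transpose))
        (q i - loglinearProb W θ₀)) =o[l] fun i => q i - loglinearProb W θ₀ := by
  have hlin := isLittleO_of_isMinPhiDivergence hW hφ hθ₀ hq hsum ht
  set A := matrixCLM ((W.transpose * multinomialCov (loglinearProb W θ₀) * W)⁻¹ * W.transpose)
  set J := matrixCLM (multinomialCov (loglinearProb W θ₀) * W) with hJ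
  have hO : (fun i => t i - θ₀) =O[l] fun i => q i - loglinearProb W θ₀ := by
    simpa using hlin.isBigO.add (A.isBigO_comp (fun i => q i - loglinearProb W θ₀) l)
  have ht0 : Tendsto t l (𝓝 θ₀) := by
    rw [← tendsto_sub_nhds_zero_iff]
    exact hO.trans_tendsto (by simpa using hq.sub_const (loglinearProb W θ₀))
  have h1 := ((hasFDerivAt_loglinearProb W θ₀).isLittleO.comp_tendsto ht0).trans_isBigO hO
  refine (h1.add ((J.isBigO_comp _ l).trans_isLittleO hlin)).congr_left fun i => ?_
  have h2 : matrixCLM (multinomialCov (loglinearProb W θ₀) * W *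
      ((W.transpose * multinomialCov (loglinearProb W θ₀) * W)⁻¹ * W.transpose))
      (q i - loglinearProb W θ₀) = J (A (q i - loglinearProb W θ₀)) := matrixCLM_mul _ _ _
  rw [h2]
  simp only [Function.comp, map_sub, ← hJ]
  abel

end MinDivergence

/-! ### A central limit theorem for bounded, not identically distributed vectors -/

/-- Factors in the unit disc are exchanged one at a time. It serves to compare a product of distinct
characteristic functions with a Gaussian one. -/
lemma norm_prod_sub_prod_le {ι : Type*} (s : Finset ι) (a b : ι → ℂ) (ha : ∀ i ∈ s, ‖a i‖ ≤ 1)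
    (hb : ∀ i ∈ s, ‖b i‖ ≤ 1) :
    ‖∏ i ∈ s, a i - ∏ i ∈ s, b i‖ ≤ ∑ i ∈ s, ‖a i - b i‖ := by
  classical
  induction s using Finset.induction_on with
  | empty => simp
  | insert i s hi ih =>
    simp only [Finset.mem_insert, forall_eq_or_imp] at ha hb
    rw [Finset.prod_insert hi, Finset.prod_insert hi, Finset.sum_insert hi]
    have h1 : a i * ∏ j ∈ s, a j - b i * ∏ j ∈ s, b j =
        (a i - b i) * ∏ j ∈ s, a j + b i * (∏ j ∈ s, a j - ∏ j ∈ s, b j) := by ring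
    rw [h1]
    refine (norm_add_le _ _).trans (add_le_add ?_ ?_)
    · rw [norm_mul, norm_prod]
      exact mul_le_of_le_one_right (norm_nonneg _)
        (Finset.prod_le_one (fun _ _ => norm_nonneg _) ha.2)
    · rw [norm_mul]
      exact (mul_le_of_le_one_left (norm_nonneg _) hb.1).trans (ih ha.2 hb.2)

lemma norm_exp_mul_I_sub_le {x : ℝ} (hx : |x| ≤ 1) :
    ‖Complex.exp (x * Complex.I) - (1 + x * Complex.I - (x ^ 2 / 2 : ℝ))‖ ≤ |x| ^ 3 := by
  have hn : ‖(x : ℂ) * Complex.I‖ = |x| := by simp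
  have h := Complex.exp_bound (x := x * Complex.I) (by rw [hn]; exact hx) (n := 3) (by norm_num)
  rw [hn] at h
  have hs : ∑ m ∈ Finset.range 3, ((x : ℂ) * Complex.I) ^ m / m.factorial =
      1 + x * Complex.I - (x ^ 2 / 2 : ℝ) := by
    simp [Finset.sum_range_succ, mul_pow, Complex.I_sq, Nat.factorial]
    ring
  rw [hs] at h
  refine h.trans (mul_le_of_le_one_right (by positivity) ?_)
  norm_num [Nat.factorial]

section CLT

variable {Ω : Type*} [MeasurableSpace Ω] {P : Measure Ω} [IsProbabilityMeasure P]

/-- Both terms are within (|u|B)³ of 1 - u²v/2: the first by third order Taylor expansion under the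
integral, the second because v ≤ B² makes the quadratic error of exp at most (|u|B)⁴. -/
lemma norm_integral_exp_mul_I_sub_le {Z : Ω → ℝ} (hZ : Measurable Z) {B v u : ℝ}
    (hb : ∀ ω, |Z ω| ≤ B) (hmean : ∫ ω, Z ω ∂P = 0) (hvar : ∫ ω, Z ω ^ 2 ∂P = v)
    (hu : |u| * B ≤ 1) :
    ‖∫ ω, Complex.exp (((u * Z ω : ℝ) : ℂ) * Complex.I) ∂P -
      Complex.exp ((-(u ^ 2 * v / 2) : ℝ) : ℂ)‖ ≤ 2 * (|u| * B) ^ 3 := by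
  have hne : Nonempty Ω := nonempty_of_isProbabilityMeasure P
  have hB : 0 ≤ B := (abs_nonneg _).trans (hb hne.some)
  have huZ : ∀ ω, |u * Z ω| ≤ |u| * B := fun ω => by
    rw [abs_mul]; exact mul_le_mul_of_nonneg_left (hb ω) (abs_nonneg _)
  have iZ : Integrable Z P := .of_bound hZ.aestronglyMeasurable B (ae_of_all _ hb)
  have iZ2 : Integrable (fun ω => Z ω ^ 2) P :=
    .of_bound (by fun_prop) (B ^ 2) (ae_of_all _ fun ω => by
      rw [norm_pow]; exact pow_le_pow_left₀ (norm_nonneg _) (hb ω) 2)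
  have iE : Integrable (fun ω => Complex.exp (((u * Z ω : ℝ) : ℂ) * Complex.I)) P :=
    .of_bound (by fun_prop) 1 (ae_of_all _ fun ω => by rw [Complex.norm_exp_ofReal_mul_I])
  have iQ : Integrable (fun ω => (1 + ((u * Z ω : ℝ) : ℂ) * Complex.I -
      (((u * Z ω) ^ 2 / 2 : ℝ) : ℂ))) P := by
    refine ((integrable_const _).add ?_).sub ?_
    · exact ((iZ.const_mul u).ofReal).mul_const _
    · refine Integrable.ofReal ?_
      simp only [mul_pow]
      exact (iZ2.const_mul _).div_const _
  have hQ : ∫ ω, (1 + ((u * Z ω : ℝ) : ℂ) * Complex.I - (((u * Z ω) ^ 2 / 2 : ℝ) : ℂ)) ∂P =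
      ((1 - u ^ 2 * v / 2 : ℝ) : ℂ) := by
    rw [integral_sub, integral_add, integral_mul_const, integral_complex_ofReal,
      integral_complex_ofReal,
      integral_const_mul, hmean, integral_div]
    · simp only [mul_pow]
      rw [integral_const_mul, hvar]
      simp
    · exact integrable_const _
    · exact ((iZ.const_mul u).ofReal).mul_const _
    · exact (integrable_const _).add (((iZ.const_mul u).ofReal).mul_const _)
    · refine Integrable.ofReal ?_
      simp only [mul_pow]
      exact (iZ2.const_mul _).div_const _
  have h1 : ‖∫ ω, Complex.exp (((u * Z ω : ℝ) : ℂ) * Complex.I) ∂P -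
      ((1 - u ^ 2 * v / 2 : ℝ) : ℂ)‖ ≤ (|u| * B) ^ 3 := by
    rw [← hQ, ← integral_sub iE iQ]
    have := norm_integral_le_of_norm_le_const (μ := P) (C := (|u| * B) ^ 3)
      (f := fun ω => Complex.exp (((u * Z ω : ℝ) : ℂ) * Complex.I) -
        (1 + ((u * Z ω : ℝ) : ℂ) * Complex.I - (((u * Z ω) ^ 2 / 2 : ℝ) : ℂ)))
      (ae_of_all _ fun ω => (norm_exp_mul_I_sub_le ((huZ ω).trans hu)).trans
        (pow_le_pow_left₀ (abs_nonneg _) (huZ ω) 3))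
    simpa using this
  have hv0 : 0 ≤ v := hvar ▸ integral_nonneg fun ω => sq_nonneg _
  have hv : v ≤ B ^ 2 := by
    rw [← hvar]
    have := integral_mono iZ2 (integrable_const (B ^ 2)) (fun ω => by
      simpa using sq_le_sq' (abs_le.1 (hb ω)).1 (abs_le.1 (hb ω)).2)
    simpa using this
  set w := u ^ 2 * v / 2 with hw
  have hw0 : 0 ≤ w := by positivity
  set z := |u| * B with hz
  have hz0 : 0 ≤ z := by positivity
  have hwz : w ≤ z ^ 2 / 2 := by
    rw [hw, hz, mul_pow, sq_abs]
    have := mul_le_mul_of_nonneg_left hv (sq_nonneg u)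
    linarith
  have hz1 : z ^ 2 ≤ 1 := pow_le_one₀ hz0 hu
  have h2 : ‖((1 - w : ℝ) : ℂ) - Complex.exp ((-w : ℝ) : ℂ)‖ ≤ z ^ 3 := by
    rw [← Complex.ofReal_exp, ← Complex.ofReal_sub, Complex.norm_real, norm_sub_rev]
    have := Real.norm_exp_sub_one_sub_id_le (x := -w) (by
      rw [norm_neg, Real.norm_of_nonneg hw0]; linarith)
    rw [norm_neg, Real.norm_of_nonneg hw0] at this
    have h3 : Real.exp (-w) - (1 - w) = Real.exp (-w) - 1 - -w := by ring
    rw [h3]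
    refine this.trans ?_
    have h4 : z ^ 4 ≤ z ^ 3 := pow_le_pow_of_le_one hz0 hu (by norm_num)
    have h5 : 0 ≤ z ^ 3 := by positivity
    nlinarith
  calc _ ≤ _ := norm_sub_le_norm_sub_add_norm_sub _ ((1 - w : ℝ) : ℂ) _
    _ ≤ _ := by linarith

/-- **Central limit theorem** for independent, uniformly bounded random vectors with mean `0` and
the same covariance matrix. -/
theorem tendstoInDistribution_inv_sqrt_smul_sum {ι : Type*} [Fintype ι] [DecidableEq ι]
    {S : Matrix ι ι ℝ} (hS : S.PosSemidef) {Y : ℕ → Ω → EuclideanSpace ℝ ι}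
    (hY : ∀ l, Measurable (Y l)) {B : ℝ} (hb : ∀ l ω, ‖Y l ω‖ ≤ B) (hindep : iIndepFun Y P)
    (hmean : ∀ l t, ∫ ω, inner ℝ (Y l ω) t ∂P = 0)
    (hvar : ∀ l t, ∫ ω, inner ℝ (Y l ω) t ^ 2 ∂P = t.ofLp ⬝ᵥ S.mulVec t.ofLp) :
    TendstoInDistribution (fun (N : ℕ) ω => (√(N : ℝ))⁻¹ • ∑ l ∈ Finset.range N, Y l ω) atTop
      (id : EuclideanSpace ℝ ι → EuclideanSpace ℝ ι) (fun _ => P) (multivariateGaussian 0 S) where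
  forall_aemeasurable N := by fun_prop
  aemeasurable_limit := by fun_prop
  tendsto := by
    refine ProbabilityMeasure.tendsto_iff_tendsto_charFun.2 fun t => ?_
    simp only [ProbabilityMeasure.coe_mk, Measure.map_id, charFun_multivariateGaussian hS]
    set v := t.ofLp ⬝ᵥ S.mulVec t.ofLp with hv
    set C := B * ‖t‖ with hC
    have hZb : ∀ l ω, |inner ℝ (Y l ω) t| ≤ C := fun l ω =>
      (abs_real_inner_le_norm _ _).trans (mul_le_mul_of_nonneg_right (hb l ω) (norm_nonneg _))
    have hchar : ∀ N : ℕ, charFun (P.map fun ω => (√(N : ℝ))⁻¹ • ∑ l ∈ Finset.range N, Y l ω) t =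
        ∏ l ∈ Finset.range N,
          ∫ ω, Complex.exp ((((√(N : ℝ))⁻¹ * inner ℝ (Y l ω) t : ℝ) : ℂ) * Complex.I) ∂P := by
      intro N
      rw [charFun_map_smul_comp (by fun_prop),
        (hindep.restrict _).charFun_map_fun_finsetSum_eq_prod fun l _ => (hY l).aemeasurable,
        Finset.prod_apply]
      refine Finset.prod_congr rfl fun l _ => ?_
      rw [charFun_apply, integral_map (hY l).aemeasurable (by fun_prop)]
      simp only [inner_smul_right]
    have hlim : ∀ᶠ N : ℕ in atTop,
        ‖charFun (P.map fun ω => (√(N : ℝ))⁻¹ • ∑ l ∈ Finset.range N, Y l ω) t -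
          Complex.exp ((-(v / 2) : ℝ) : ℂ)‖ ≤ 2 * C ^ 3 * (√(N : ℝ))⁻¹ := by
      have hsq : Tendsto (fun N : ℕ => (√(N : ℝ))⁻¹) atTop (𝓝 0) :=
        tendsto_inv_atTop_zero.comp (Real.tendsto_sqrt_atTop.comp tendsto_natCast_atTop_atTop)
      have hsmall : ∀ᶠ N : ℕ in atTop, (√(N : ℝ))⁻¹ * C ≤ 1 := by
        have : Tendsto (fun N : ℕ => (√(N : ℝ))⁻¹ * C) atTop (𝓝 0) := by
          simpa using hsq.mul_const C
        exact this.eventually_le_const one_pos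
      filter_upwards [hsmall, eventually_gt_atTop 0] with N hN hN0
      have hN0' : (0 : ℝ) < N := Nat.cast_pos.2 hN0
      have hu : |(√(N : ℝ))⁻¹| = (√(N : ℝ))⁻¹ := abs_of_nonneg (by positivity)
      -- The Gaussian characteristic function is split into N equal factors; each costs an error
      -- 2(C/√N)³, in total 2C³/√N.
      have hprod : Complex.exp ((-(v / 2) : ℝ) : ℂ) =
          ∏ _l ∈ Finset.range N, Complex.exp ((-((√(N : ℝ))⁻¹ ^ 2 * v / 2) : ℝ) : ℂ) := by
        rw [Finset.prod_const, Finset.card_range, ← Complex.exp_nat_mul, inv_pow,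
          Real.sq_sqrt hN0'.le]
        congr 1
        have hNc : (N : ℂ) ≠ 0 := Nat.cast_ne_zero.2 hN0.ne'
        push_cast
        field_simp
      have hv0 : 0 ≤ v := by
        rw [hv, ← hvar 0 t]; exact integral_nonneg fun ω => sq_nonneg _
      rw [hchar, hprod]
      refine (norm_prod_sub_prod_le _ _ _ (fun l _ => ?_) (fun l _ => ?_)).trans ?_
      · refine (norm_integral_le_of_norm_le_const (C := 1) (ae_of_all _ fun ω => ?_)).trans ?_
        · rw [Complex.norm_exp_ofReal_mul_I]
        · simp
      · rw [← Complex.ofReal_exp, Complex.norm_real, Real.norm_of_nonneg (Real.exp_pos _).le,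
          Real.exp_le_one_iff, Left.neg_nonpos_iff]
        positivity
      · have := Finset.sum_le_sum fun l (_ : l ∈ Finset.range N) =>
          norm_integral_exp_mul_I_sub_le (P := P) (Z := fun ω => inner ℝ (Y l ω) t)
            (u := (√(N : ℝ))⁻¹) (by fun_prop) (hZb l) (hmean l t) (hvar l t) (by rwa [hu])
        refine this.trans (le_of_eq ?_)
        rw [Finset.sum_const, Finset.card_range, nsmul_eq_mul, hu]
        have hs : √(N : ℝ) ≠ 0 := by positivity
        have h2 : (N : ℝ) = √(N : ℝ) ^ 2 := (Real.sq_sqrt hN0'.le).symm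
        rw [mul_pow, inv_pow]
        nth_rw 1 [h2]
        field_simp
    have hgoal : Complex.exp (((inner ℝ t (0 : EuclideanSpace ℝ ι) : ℝ) : ℂ) * Complex.I -
        (v : ℂ) / 2) = Complex.exp ((-(v / 2) : ℝ) : ℂ) := by
      congr 1
      simp
    rw [hgoal, tendsto_iff_norm_sub_tendsto_zero]
    refine squeeze_zero' (Eventually.of_forall fun _ => norm_nonneg _) hlim ?_
    have hsq : Tendsto (fun N : ℕ => (√(N : ℝ))⁻¹) atTop (𝓝 0) :=
      tendsto_inv_atTop_zero.comp (Real.tendsto_sqrt_atTop.comp tendsto_natCast_atTop_atTop)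
    simpa using hsq.const_mul (2 * C ^ 3)

end CLT

/-! ### Asymptotic normality of asymptotically linear statistics -/

section AsymptoticallyLinear

variable {Ω : Type*} [MeasurableSpace Ω] {P : Measure Ω} [IsProbabilityMeasure P] {M : ℕ}
  {S : Matrix (Fin M) (Fin M) ℝ} {Y : ℕ → Ω → EuclideanSpace ℝ (Fin M)} {B : ℝ}

lemma inner_matrixCLM_eq_sum {a : ℕ} (A : Matrix (Fin a) (Fin M) ℝ)
    (y : EuclideanSpace ℝ (Fin M)) (t : EuclideanSpace ℝ (Fin a)) :
    inner ℝ (matrixCLM A y) t = ∑ r, A.transpose.mulVec t.ofLp r * y r := by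
  rw [EuclideanSpace.inner_eq_star_dotProduct, star_trivial, ofLp_matrixCLM,
    Matrix.dotProduct_mulVec, ← Matrix.mulVec_transpose]
  rfl

lemma memLp_apply_of_bound {p : ENNReal} {Z : Ω → EuclideanSpace ℝ (Fin M)} (hZ : Measurable Z)
    (hb : ∀ ω, ‖Z ω‖ ≤ B) (r : Fin M) : MemLp (fun ω => Z ω r) p P :=
  .of_bound (by fun_prop) B (ae_of_all _ fun ω => (PiLp.norm_apply_le (Z ω) r).trans (hb ω))

lemma integral_inner_matrixCLM {a : ℕ} (A : Matrix (Fin a) (Fin M) ℝ)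
    {Z : Ω → EuclideanSpace ℝ (Fin M)} (hZ : Measurable Z) (hb : ∀ ω, ‖Z ω‖ ≤ B)
    (hmean : ∀ r, ∫ ω, Z ω r ∂P = 0) (t : EuclideanSpace ℝ (Fin a)) :
    ∫ ω, inner ℝ (matrixCLM A (Z ω)) t ∂P = 0 := by
  simp only [inner_matrixCLM_eq_sum]
  rw [integral_finsetSum _ fun r _ =>
    (memLp_one_iff_integrable.1 (memLp_apply_of_bound hZ hb r)).const_mul _]
  simp [integral_const_mul, hmean]

lemma integral_inner_matrixCLM_sq {a : ℕ} (A : Matrix (Fin a) (Fin M) ℝ)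
    {Z : Ω → EuclideanSpace ℝ (Fin M)} (hZ : Measurable Z) (hb : ∀ ω, ‖Z ω‖ ≤ B)
    (hcov : ∀ r s, ∫ ω, Z ω r * Z ω s ∂P = S r s) (t : EuclideanSpace ℝ (Fin a)) :
    ∫ ω, inner ℝ (matrixCLM A (Z ω)) t ^ 2 ∂P =
      t.ofLp ⬝ᵥ (A * S * A.transpose).mulVec t.ofLp := by
  have hint : ∀ r s, Integrable (fun ω => Z ω r * Z ω s) P := fun r s =>
    (memLp_apply_of_bound (p := 2) hZ hb r).integrable_mul
      (memLp_apply_of_bound (p := 2) hZ hb s)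
  set c := A.transpose.mulVec t.ofLp with hc
  have hsq : ∀ ω, inner ℝ (matrixCLM A (Z ω)) t ^ 2 =
      ∑ r, ∑ s, c r * c s * (Z ω r * Z ω s) := fun ω => by
    rw [inner_matrixCLM_eq_sum, pow_two, Finset.sum_mul_sum]
    exact Finset.sum_congr rfl fun r _ => Finset.sum_congr rfl fun s _ => by ring
  simp only [hsq]
  rw [integral_finsetSum _ fun r _ => integrable_finsetSum _ fun s _ => (hint r s).const_mul _]
  have hR : t.ofLp ⬝ᵥ (A * S * A.transpose).mulVec t.ofLp = c ⬝ᵥ S.mulVec c := by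
    rw [← Matrix.mulVec_mulVec, ← Matrix.mulVec_mulVec, Matrix.dotProduct_mulVec,
      ← Matrix.mulVec_transpose]
  rw [hR, dotProduct]
  refine Finset.sum_congr rfl fun r _ => ?_
  rw [integral_finsetSum _ fun s _ => (hint r s).const_mul _, Matrix.mulVec, dotProduct,
    Finset.mul_sum]
  refine Finset.sum_congr rfl fun s _ => ?_
  rw [integral_const_mul, hcov]
  ring

/-- Independence removes the covariances between clusters. Through Markov's inequality this makes
the norm of the sum of order √N in probability. -/
lemma integral_sq_norm_sum (hY : ∀ l, Measurable (Y l)) (hb : ∀ l ω, ‖Y l ω‖ ≤ B)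
    (hindep : iIndepFun Y P) (hmean : ∀ l r, ∫ ω, Y l ω r ∂P = 0)
    (hcov : ∀ l r s, ∫ ω, Y l ω r * Y l ω s ∂P = S r s) (N : ℕ) :
    ∫ ω, ‖∑ l ∈ Finset.range N, Y l ω‖ ^ 2 ∂P = N * ∑ r, S r r := by
  have hL : ∀ l r, MemLp (fun ω => Y l ω r) 2 P := fun l r =>
    memLp_apply_of_bound (hY l) (hb l) r
  have hLs : ∀ r, MemLp (fun ω => ∑ l ∈ Finset.range N, Y l ω r) 2 P := fun r =>
    memLp_finsetSum _ fun l _ => hL l r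
  have hnorm : ∀ ω, ‖∑ l ∈ Finset.range N, Y l ω‖ ^ 2 =
      ∑ r, (∑ l ∈ Finset.range N, Y l ω r) ^ 2 := fun ω => by
    rw [EuclideanSpace.real_norm_sq_eq]
    simp only [WithLp.ofLp_sum, Finset.sum_apply]
  simp only [hnorm]
  rw [integral_finsetSum _ fun r _ => (hLs r).integrable_sq, Finset.mul_sum]
  refine Finset.sum_congr rfl fun r _ => ?_
  have hmean' : ∫ ω, ∑ l ∈ Finset.range N, Y l ω r ∂P = 0 := by
    rw [integral_finsetSum _ fun l _ => (hL l r).integrable one_le_two]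
    simp [hmean]
  have hvar : Var[∑ l ∈ Finset.range N, fun ω => Y l ω r; P] =
      ∑ l ∈ Finset.range N, Var[fun ω => Y l ω r; P] := by
    refine IndepFun.variance_sum (fun l _ => hL l r) fun i _ j _ hij => ?_
    exact (hindep.indepFun hij).comp (φ := fun y : EuclideanSpace ℝ (Fin M) => y r)
      (ψ := fun y : EuclideanSpace ℝ (Fin M) => y r) (by fun_prop) (by fun_prop)
  have hfun : (∑ l ∈ Finset.range N, fun ω => Y l ω r) =
      fun ω => ∑ l ∈ Finset.range N, Y l ω r := by
    funext ω; simp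
  rw [hfun, variance_of_integral_eq_zero (hLs r).aemeasurable hmean'] at hvar
  rw [hvar, Finset.sum_congr rfl fun l _ =>
    variance_of_integral_eq_zero (hL l r).aemeasurable (hmean l r)]
  simp only [pow_two, hcov, Finset.sum_const, Finset.card_range, nsmul_eq_mul]

/-- Delta method for statistics that are asymptotically linear in a mean of independent bounded
vectors with equal covariance matrices. -/
theorem tendstoInDistribution_of_asymptoticallyLinear (hS : S.PosSemidef)
    (hY : ∀ l, Measurable (Y l)) (hb : ∀ l ω, ‖Y l ω‖ ≤ B)
    (hindep : iIndepFun Y P) (hmean : ∀ l r, ∫ ω, Y l ω r ∂P = 0)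
    (hcov : ∀ l r s, ∫ ω, Y l ω r * Y l ω s ∂P = S r s) {a : ℕ} (A : Matrix (Fin a) (Fin M) ℝ)
    {T : ℕ → Ω → EuclideanSpace ℝ (Fin a)} (hT : ∀ N, 1 ≤ N → AEMeasurable (T N) P)
    (hlin : ∀ ε > 0, ∃ δ > 0, ∀ N : ℕ, 1 ≤ N → ∀ᵐ ω ∂P,
      ‖(N : ℝ)⁻¹ • ∑ l ∈ Finset.range N, Y l ω‖ < δ →
        ‖T N ω - matrixCLM A ((N : ℝ)⁻¹ • ∑ l ∈ Finset.range N, Y l ω)‖ ≤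
          ε * ‖(N : ℝ)⁻¹ • ∑ l ∈ Finset.range N, Y l ω‖) :
    TendstoInDistribution (fun (N : ℕ) ω => √(N : ℝ) • T N ω) atTop
      (id : EuclideanSpace ℝ (Fin a) → EuclideanSpace ℝ (Fin a)) (fun _ => P)
      (multivariateGaussian 0 (A * S * A.transpose)) := by
  have hclt := tendstoInDistribution_inv_sqrt_smul_sum (P := P)
    (S := A * S * A.transpose) (Y := fun l ω => matrixCLM A (Y l ω)) (B := ‖matrixCLM A‖ * B)
    (by simpa [Matrix.conjTranspose_eq_transpose_of_trivial] using hS.mul_mul_conjTranspose_same A)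
    (fun l => (matrixCLM A).continuous.measurable.comp (hY l))
    (fun l ω => ((matrixCLM A).le_opNorm _).trans
      (mul_le_mul_of_nonneg_left (hb l ω) (norm_nonneg _)))
    (hindep.comp (fun _ => matrixCLM A) fun _ => (matrixCLM A).continuous.measurable)
    (fun l => integral_inner_matrixCLM A (hY l) (hb l) (hmean l))
    (fun l => integral_inner_matrixCLM_sq A (hY l) (hb l) (hcov l))
  -- Slutsky: √N T_N differs from the normalized sum of the A Y_l by a term tending to 0 in
  -- probability.
  refine tendstoInDistribution_of_tendstoInMeasure_sub _ _ hclt ?_ fun N => ?_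
  · rw [tendstoInMeasure_iff_measureReal_norm]
    intro ε hε
    set C := ∑ r, S r r with hC
    have hC0 : 0 ≤ C := Finset.sum_nonneg fun r _ => hS.diag_nonneg
    rw [Metric.tendsto_nhds]
    intro η hη
    set k := min 1 (η / (C + 1)) with hk
    have hk0 : 0 < k := by positivity
    have hk1 : k ≤ 1 := min_le_left _ _
    have hCk : C * k ^ 2 < η := by
      have h1 : k * (C + 1) ≤ η := (le_div_iff₀ (by positivity)).1 (min_le_right _ _)
      have h2 : C * k ^ 2 ≤ C * k := by
        rw [pow_two]; exact mul_le_mul_of_nonneg_left (mul_le_of_le_one_left hk0.le hk1) hC0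
      nlinarith
    -- Where the sum has norm below √N/k, relative accuracy εk gives an error below ε after scaling
    -- by √N. The exceptional event has probability at most Ck² < η.
    obtain ⟨δ, hδ, hδlin⟩ := hlin (ε * k) (by positivity)
    have hlarge : ∀ᶠ N : ℕ in atTop, (1 : ℝ) / (k * δ) ≤ √(N : ℝ) :=
      (Real.tendsto_sqrt_atTop.comp tendsto_natCast_atTop_atTop).eventually_ge_atTop _
    filter_upwards [hlarge, eventually_ge_atTop 1] with N hN hN1
    have hN0 : (0 : ℝ) < N := by exact_mod_cast hN1
    have hs0 : 0 < √(N : ℝ) := Real.sqrt_pos.2 hN0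
    have hss : √(N : ℝ) * √(N : ℝ) = N := Real.mul_self_sqrt hN0.le
    have hsub : P.real {ω | ε ≤ ‖((fun (N : ℕ) ω => √(N : ℝ) • T N ω) -
        fun (N : ℕ) ω => (√(N : ℝ))⁻¹ • ∑ l ∈ Finset.range N, matrixCLM A (Y l ω)) N ω -
          (0 : ℕ → Ω → EuclideanSpace ℝ (Fin a)) N ω‖} ≤
        P.real {ω | N / k ^ 2 ≤ ‖∑ l ∈ Finset.range N, Y l ω‖ ^ 2} := by
      refine ENNReal.toReal_mono (measure_ne_top _ _) (measure_mono_ae ?_)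
      filter_upwards [hδlin N hN1] with ω hω
      intro hε'
      change ε ≤ _ at hε'
      change N / k ^ 2 ≤ ‖∑ l ∈ Finset.range N, Y l ω‖ ^ 2
      by_contra! hlt
      set Z := ∑ l ∈ Finset.range N, Y l ω with hZ
      have hZlt : ‖Z‖ * k < √(N : ℝ) := by
        refine lt_of_pow_lt_pow_left₀ 2 hs0.le ?_
        rw [mul_pow, Real.sq_sqrt hN0.le]
        exact (lt_div_iff₀ (by positivity)).1 hlt
      have hnorm : ‖(N : ℝ)⁻¹ • Z‖ = ‖Z‖ / N := by
        rw [norm_smul, norm_inv, Real.norm_of_nonneg hN0.le, inv_mul_eq_div]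
      have hZδ : ‖(N : ℝ)⁻¹ • Z‖ < δ := by
        rw [hnorm, div_lt_iff₀ hN0, ← hss]
        have h1 : 1 ≤ √(N : ℝ) * (k * δ) := (div_le_iff₀ (by positivity)).1 hN
        have h2 : ‖Z‖ * k < k * (δ * (√(N : ℝ) * √(N : ℝ))) := by
          calc ‖Z‖ * k < √(N : ℝ) := hZlt
            _ = √(N : ℝ) * 1 := (mul_one _).symm
            _ ≤ √(N : ℝ) * (√(N : ℝ) * (k * δ)) := mul_le_mul_of_nonneg_left h1 hs0.le
            _ = _ := by ring
        rw [mul_comm] at h2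
        exact lt_of_mul_lt_mul_left h2 hk0.le
      have hbound := hω hZδ
      have hdiff : ((fun (N : ℕ) ω => √(N : ℝ) • T N ω) -
          fun (N : ℕ) ω => (√(N : ℝ))⁻¹ • ∑ l ∈ Finset.range N, matrixCLM A (Y l ω)) N ω -
          (0 : ℕ → Ω → EuclideanSpace ℝ (Fin a)) N ω =
          √(N : ℝ) • (T N ω - matrixCLM A ((N : ℝ)⁻¹ • Z)) := by
        have h1 : (√(N : ℝ))⁻¹ = √(N : ℝ) * (N : ℝ)⁻¹ := by
          rw [inv_eq_iff_eq_inv, mul_inv, inv_inv, inv_mul_eq_div, eq_div_iff hs0.ne', hss]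
        simp only [Pi.sub_apply, Pi.zero_apply, sub_zero]
        rw [← map_sum, ← hZ, smul_sub, map_smul, smul_smul, h1]
      rw [hdiff, norm_smul, Real.norm_of_nonneg hs0.le] at hε'
      have h3 : √(N : ℝ) * (ε * k * (‖Z‖ / N)) < ε := by
        have : √(N : ℝ) * (ε * k * (‖Z‖ / N)) = ε * (‖Z‖ * k / √(N : ℝ)) := by
          rw [mul_div_assoc', mul_div_assoc', mul_div_assoc', div_eq_div_iff hN0.ne' hs0.ne']
          linear_combination ε * k * ‖Z‖ * hss
        rw [this]
        exact mul_lt_of_lt_one_right hε ((div_lt_one hs0).2 hZlt)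
      rw [hnorm] at hbound
      linarith [mul_le_mul_of_nonneg_left hbound hs0.le]
    have hmarkov : P.real {ω | N / k ^ 2 ≤ ‖∑ l ∈ Finset.range N, Y l ω‖ ^ 2} ≤ C * k ^ 2 := by
      have hint : Integrable (fun ω => ‖∑ l ∈ Finset.range N, Y l ω‖ ^ 2) P := by
        refine .of_bound (by fun_prop) ((N * B) ^ 2) (ae_of_all _ fun ω => ?_)
        rw [norm_pow, norm_norm]
        refine pow_le_pow_left₀ (norm_nonneg _) ((norm_sum_le _ _).trans ?_) 2
        have := Finset.sum_le_sum fun l (_ : l ∈ Finset.range N) => hb l ω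
        simpa using this
      have h1 := mul_meas_ge_le_integral_of_nonneg (μ := P)
        (ae_of_all _ fun ω => sq_nonneg ‖∑ l ∈ Finset.range N, Y l ω‖) hint (N / k ^ 2)
      rw [integral_sq_norm_sum hY hb hindep hmean hcov, div_mul_eq_mul_div,
        div_le_iff₀ (by positivity), mul_assoc] at h1
      exact le_of_mul_le_mul_left h1 hN0
    rw [Real.dist_eq, sub_zero, abs_of_nonneg measureReal_nonneg]
    exact (hsub.trans hmarkov).trans_lt hCk
  -- Measurability of `T 0` is not assumed, but the factor √0 makes this term constant.
  · rcases Nat.eq_zero_or_pos N with rfl | h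
    · simp only [Nat.cast_zero, Real.sqrt_zero, zero_smul]
      exact aemeasurable_const
    · exact (hT N h).const_smul (√(N : ℝ))

end AsymptoticallyLinear

/-! ### Clustered multinomial data -/

section ClusteredMultinomial

variable {M M₀ n : ℕ} {W : Matrix (Fin M) (Fin M₀) ℝ} {θ₀ : EuclideanSpace ℝ (Fin M₀)}

/-- The deviation of the relative frequencies in one cluster from the model probabilities. -/
noncomputable def centeredFrequency (p : EuclideanSpace ℝ (Fin M)) (x : Fin n → Fin M) :
    EuclideanSpace ℝ (Fin M) :=
  WithLp.toLp 2 fun r => (n : ℝ)⁻¹ * cellCount x r - p r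

lemma measurable_centeredFrequency (p : EuclideanSpace ℝ (Fin M)) :
    Measurable (centeredFrequency p : (Fin n → Fin M) → EuclideanSpace ℝ (Fin M)) :=
  measurable_of_finite _

lemma pHat_sub_eq {N : ℕ} (hN : 1 ≤ N) (p : EuclideanSpace ℝ (Fin M))
    (x : ℕ → Fin n → Fin M) :
    pHat N x - p = (N : ℝ)⁻¹ • ∑ l ∈ Finset.range N, centeredFrequency p (x l) := by
  have hN0 : (N : ℝ) ≠ 0 := by positivity
  ext r
  simp only [pHat, centeredFrequency, PiLp.sub_apply, PiLp.smul_apply, WithLp.ofLp_sum,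
    Finset.sum_apply, Finset.sum_sub_distrib, ← Finset.mul_sum, Finset.sum_const,
    Finset.card_range, nsmul_eq_mul, smul_eq_mul]
  rw [mul_sub, inv_mul_cancel_left₀ hN0, mul_inv]
  ring

lemma sum_cellCount (x : Fin n → Fin M) : ∑ r, cellCount x r = n := by
  simp only [cellCount]
  rw [Finset.sum_comm]
  simp

lemma sum_pHat (hn : 1 ≤ n) {N : ℕ} (hN : 1 ≤ N) (x : ℕ → Fin n → Fin M) :
    ∑ r, pHat N x r = 1 := by
  have hn0 : (n : ℝ) ≠ 0 := by positivity
  have hN0 : (N : ℝ) ≠ 0 := by positivity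
  simp only [pHat, ← Finset.mul_sum]
  rw [Finset.sum_comm]
  simp only [sum_cellCount, Finset.sum_const, Finset.card_range, nsmul_eq_mul]
  field_simp

variable {Ω : Type*} [MeasurableSpace Ω] {P : Measure Ω} {rhoSq : ℝ}
  {X : ℕ → Ω → Fin n → Fin M}

namespace IsClusteredMultinomial

/-- Dividing the counts by n turns the covariance ϑ_n n Σ into (ϑ_n/n) Σ. -/
lemma integral_centeredFrequency_mul (hn : 1 ≤ n)
    (hX : IsClusteredMultinomial P W θ₀ rhoSq X) (l : ℕ) (r s : Fin M) :
    ∫ ω, centeredFrequency (loglinearProb W θ₀) (X l ω) r *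
        centeredFrequency (loglinearProb W θ₀) (X l ω) s ∂P =
      ((designEffect n rhoSq / n) • multinomialCov (loglinearProb W θ₀)) r s := by
  have hn0 : (n : ℝ) ≠ 0 := by positivity
  have h := hX.cov l r s
  simp only [covariance, hX.mean] at h
  have hpt : ∀ ω, centeredFrequency (loglinearProb W θ₀) (X l ω) r *
        centeredFrequency (loglinearProb W θ₀) (X l ω) s =
      ((n : ℝ)⁻¹ * (n : ℝ)⁻¹) * ((cellCount (X l ω) r - n * loglinearProb W θ₀ r) *
        (cellCount (X l ω) s - n * loglinearProb W θ₀ s)) := fun ω => by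
    simp only [centeredFrequency]
    field_simp
  simp only [hpt]
  rw [integral_const_mul, h, Matrix.smul_apply, smul_eq_mul]
  field_simp

variable [IsProbabilityMeasure P]

lemma integrable_cellCount (hX : IsClusteredMultinomial P W θ₀ rhoSq X) (l : ℕ) (r : Fin M) :
    Integrable (fun ω => cellCount (X l ω) r) P := by
  obtain ⟨B, hB⟩ := Finite.exists_le fun x : Fin n → Fin M => ‖cellCount x r‖
  refine .of_bound (Measurable.aestronglyMeasurable ?_) B (ae_of_all _ fun ω => hB _)
  exact (measurable_of_finite fun x : Fin n → Fin M => cellCount x r).comp (hX.measurable l)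

lemma integral_centeredFrequency (hn : 1 ≤ n) (hX : IsClusteredMultinomial P W θ₀ rhoSq X)
    (l : ℕ) (r : Fin M) :
    ∫ ω, centeredFrequency (loglinearProb W θ₀) (X l ω) r ∂P = 0 := by
  have hn0 : (n : ℝ) ≠ 0 := by positivity
  simp only [centeredFrequency]
  rw [integral_sub ((hX.integrable_cellCount l r).const_mul _) (integrable_const _),
    integral_const_mul, hX.mean, inv_mul_cancel_left₀ hn0]
  simp

end IsClusteredMultinomial

lemma designEffect_nonneg (hn : 1 ≤ n) (hrho : 0 ≤ rhoSq) : 0 ≤ designEffect n rhoSq := by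
  have : (1 : ℝ) ≤ n := by exact_mod_cast hn
  have := mul_nonneg (sub_nonneg.2 this) hrho
  rw [designEffect]
  linarith

/-- Statistics that are asymptotically linear in the relative frequencies are asymptotically
normal. -/
theorem IsClusteredMultinomial.tendstoInDistribution [IsProbabilityMeasure P] (hn : 1 ≤ n)
    [NeZero M]
    (hrho : 0 ≤ rhoSq) (hX : IsClusteredMultinomial P W θ₀ rhoSq X) {a : ℕ}
    (A : Matrix (Fin a) (Fin M) ℝ) {T : ℕ → Ω → EuclideanSpace ℝ (Fin a)}
    (hT : ∀ N, 1 ≤ N → AEMeasurable (T N) P)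
    (hlin : ∀ ε > 0, ∃ δ > 0, ∀ N : ℕ, 1 ≤ N → ∀ᵐ ω ∂P,
      ‖pHat N (fun l => X l ω) - loglinearProb W θ₀‖ < δ →
        ‖T N ω - matrixCLM A (pHat N (fun l => X l ω) - loglinearProb W θ₀)‖ ≤
          ε * ‖pHat N (fun l => X l ω) - loglinearProb W θ₀‖) :
    TendstoInDistribution (fun (N : ℕ) ω => √(N : ℝ) • T N ω) atTop
      (id : EuclideanSpace ℝ (Fin a) → EuclideanSpace ℝ (Fin a)) (fun _ => P)
      (multivariateGaussian 0 ((designEffect n rhoSq / n) •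
        (A * multinomialCov (loglinearProb W θ₀) * A.transpose))) := by
  obtain ⟨B, hB⟩ := Finite.exists_le fun x : Fin n → Fin M =>
    ‖centeredFrequency (loglinearProb W θ₀) x‖
  have hS : ((designEffect n rhoSq / n) • multinomialCov (loglinearProb W θ₀)).PosSemidef :=
    (posSemidef_multinomialCov (fun r => (loglinearProb_pos W θ₀ r).le)
      (sum_loglinearProb W θ₀)).smul (div_nonneg (designEffect_nonneg hn hrho) n.cast_nonneg)
  have h := tendstoInDistribution_of_asymptoticallyLinear (P := P) hS
    (Y := fun l ω => centeredFrequency (loglinearProb W θ₀) (X l ω))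
    (fun l => (measurable_centeredFrequency _).comp (hX.measurable l)) (fun l ω => hB (X l ω))
    (hX.indep.comp (fun _ => centeredFrequency (loglinearProb W θ₀))
      fun _ => measurable_centeredFrequency _)
    (hX.integral_centeredFrequency hn) (hX.integral_centeredFrequency_mul hn) A hT fun ε hε => by
      obtain ⟨δ, hδ, h⟩ := hlin ε hε
      refine ⟨δ, hδ, fun N hN => ?_⟩
      filter_upwards [h N hN] with ω hω
      rwa [← pHat_sub_eq hN]
  rwa [Matrix.mul_smul, Matrix.smul_mul] at h

/-- Linearizations of functions of minimum divergence estimates hold uniformly over the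
estimates. -/
lemma exists_forall_norm_sub_le_of_isLittleO {φ : ℝ → ℝ} {Θ : Set (EuclideanSpace ℝ (Fin M₀))}
    {a : ℕ} {f : EuclideanSpace ℝ (Fin M₀) → EuclideanSpace ℝ (Fin a)}
    {L : EuclideanSpace ℝ (Fin M) → EuclideanSpace ℝ (Fin a)} {p : EuclideanSpace ℝ (Fin M)}
    (h : ∀ l : Filter (EuclideanSpace ℝ (Fin M) × EuclideanSpace ℝ (Fin M₀)),
      Tendsto Prod.fst l (𝓝 p) → (∀ᶠ i in l, ∑ r, i.1 r = 1) →
      (∀ᶠ i in l, IsMinPhiDivergence φ W Θ i.1 i.2) →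
      (fun i => f i.2 - L (i.1 - p)) =o[l] fun i => i.1 - p) {ε : ℝ} (hε : 0 < ε) :
    ∀ᶠ q in 𝓝 p, ∀ t, ∑ r, q r = 1 → IsMinPhiDivergence φ W Θ q t →
      ‖f t - L (q - p)‖ ≤ ε * ‖q - p‖ := by
  -- The filter is the universal one: all pairs (q, t) with t a minimizer for q, as q → p.
  -- Uniformity in t comes with it, without selecting a minimizer.
  have h1 := (h (comap Prod.fst (𝓝 p) ⊓
      𝓟 {i | ∑ r, i.1 r = 1 ∧ IsMinPhiDivergence φ W Θ i.1 i.2})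
    (tendsto_comap.mono_left inf_le_left)
    (mem_inf_of_right fun i hi => hi.1) (mem_inf_of_right fun i hi => hi.2)).def hε
  rw [eventually_inf_principal, eventually_comap] at h1
  filter_upwards [h1] with q hq t hsum ht using hq (q, t) rfl ⟨hsum, ht⟩

end ClusteredMultinomial

theorem theorem1 {M M₀ n : ℕ} (hn : 1 ≤ n)
    (W : Matrix (Fin M) (Fin M₀) ℝ)
    (hW : LinearIndependent ℝ
      (Fin.cons (fun _ => 1) (fun j i => W i j) : Fin (M₀ + 1) → Fin M → ℝ))
    (Θ : Set (EuclideanSpace ℝ (Fin M₀))) (θ₀ : EuclideanSpace ℝ (Fin M₀))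
    (hθ₀ : θ₀ ∈ interior Θ)
    (rhoSq : ℝ) (hrho : rhoSq ∈ Set.Icc (0 : ℝ) 1)
    (φ : ℝ → ℝ) (hφ : IsPhiFunction φ)
    {Ω : Type*} [MeasurableSpace Ω] (P : Measure Ω) [IsProbabilityMeasure P]
    (X : ℕ → Ω → Fin n → Fin M) (hX : IsClusteredMultinomial P W θ₀ rhoSq X)
    (θhat : ℕ → Ω → EuclideanSpace ℝ (Fin M₀))
    (hθhat : ∀ N, 1 ≤ N → IsQMPhiE P φ W Θ X N (θhat N)) :
    TendstoInDistribution
        (fun (N : ℕ) ω => √(N : ℝ) • (θhat N ω - θ₀)) atTop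
        (id : EuclideanSpace ℝ (Fin M₀) → EuclideanSpace ℝ (Fin M₀)) (fun _ => P)
        (multivariateGaussian 0 ((designEffect n rhoSq / n) •
          (W.transpose * multinomialCov (loglinearProb W θ₀) * W)⁻¹)) ∧
      TendstoInDistribution
        (fun (N : ℕ) ω => √(N : ℝ) • (loglinearProb W (θhat N ω) - loglinearProb W θ₀)) atTop
        (id : EuclideanSpace ℝ (Fin M) → EuclideanSpace ℝ (Fin M)) (fun _ => P)
        (multivariateGaussian 0 ((designEffect n rhoSq / n) •
          (multinomialCov (loglinearProb W θ₀) * W *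
            (W.transpose * multinomialCov (loglinearProb W θ₀) * W)⁻¹ *
            W.transpose * multinomialCov (loglinearProb W θ₀)))) := by
  have := neZero_of_linearIndependent_cons hW
  have hw0 := loglinearProb_pos W θ₀
  have hw1 := sum_loglinearProb W θ₀
  have hpd := posDef_transpose_mul_multinomialCov_mul hW hw0 hw1
  have hdet := (Matrix.isUnit_iff_isUnit_det _).1 hpd.isUnit
  set w := loglinearProb W θ₀ with hw
  set V := multinomialCov w with hV
  set F := W.transpose * V * W with hF
  have hVT : V.transpose = V := multinomialCov_isSymm w
  have hFT : F⁻¹.transpose = F⁻¹ := by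
    rw [Matrix.transpose_nonsing_inv, hF, Matrix.transpose_mul, Matrix.transpose_mul,
      Matrix.transpose_transpose, hVT, Matrix.mul_assoc]
  -- The sandwich collapses because its middle part WᵀΣW is F itself.
  have hcov : F⁻¹ * W.transpose * V * (F⁻¹ * W.transpose).transpose = F⁻¹ := by
    rw [Matrix.transpose_mul, Matrix.transpose_transpose, hFT]
    calc F⁻¹ * W.transpose * V * (W * F⁻¹) = F⁻¹ * F * F⁻¹ := by
          simp only [hF, Matrix.mul_assoc]
      _ = F⁻¹ := by rw [Matrix.nonsing_inv_mul _ hdet, Matrix.one_mul]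
  have hcov' : V * W * (F⁻¹ * W.transpose) * V * (V * W * (F⁻¹ * W.transpose)).transpose =
      V * W * F⁻¹ * W.transpose * V := by
    calc _ = V * W * (F⁻¹ * W.transpose * V * (F⁻¹ * W.transpose).transpose) *
          (V * W).transpose := by
          rw [Matrix.transpose_mul (V * W)]
          simp only [Matrix.mul_assoc]
      _ = _ := by
          rw [hcov, Matrix.transpose_mul, hVT]
          simp only [Matrix.mul_assoc]
  have hlinear : ∀ {a : ℕ} (A : Matrix (Fin a) (Fin M) ℝ)
      (f : EuclideanSpace ℝ (Fin M₀) → EuclideanSpace ℝ (Fin a)),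
      (∀ l : Filter (EuclideanSpace ℝ (Fin M) × EuclideanSpace ℝ (Fin M₀)),
        Tendsto Prod.fst l (𝓝 w) → (∀ᶠ i in l, ∑ r, i.1 r = 1) →
        (∀ᶠ i in l, IsMinPhiDivergence φ W Θ i.1 i.2) →
        (fun i => f i.2 - matrixCLM A (i.1 - w)) =o[l] fun i => i.1 - w) →
      ∀ ε > 0, ∃ δ > 0, ∀ N : ℕ, 1 ≤ N → ∀ᵐ ω ∂P, ‖pHat N (fun l => X l ω) - w‖ < δ →
        ‖f (θhat N ω) - matrixCLM A (pHat N (fun l => X l ω) - w)‖ ≤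
          ε * ‖pHat N (fun l => X l ω) - w‖ := by
    intro a A f hf ε hε
    obtain ⟨δ, hδ, hball⟩ := Metric.eventually_nhds_iff_ball.1
      ((exists_forall_norm_sub_le_of_isLittleO hf hε).and
        (eventually_exists_isMinPhiDivergence hW hφ hθ₀))
    refine ⟨δ, hδ, fun N hN => ?_⟩
    -- The estimator is constrained only when a minimizer exists, and p̂ within δ of w guarantees
    -- one.
    filter_upwards [(hθhat N hN).isMin] with ω hω hlt
    obtain ⟨h1, h2⟩ := hball _ (mem_ball_iff_norm.2 hlt)
    exact h1 _ (sum_pHat hn hN _) (hω h2)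
  constructor
  · have := hX.tendstoInDistribution hn hrho.1 (F⁻¹ * W.transpose)
      (T := fun N ω => θhat N ω - θ₀) (fun N hN => (hθhat N hN).aemeasurable.sub_const _)
      (hlinear _ (fun t => t - θ₀) fun l h1 h2 h3 =>
        isLittleO_of_isMinPhiDivergence hW hφ hθ₀ h1 h2 h3)
    rwa [← hw, ← hV, hcov] at this
  · have := hX.tendstoInDistribution hn hrho.1 (V * W * (F⁻¹ * W.transpose))
      (T := fun N ω => loglinearProb W (θhat N ω) - w)
      (fun N hN => ((continuous_loglinearProb W).measurable.comp_aemeasurable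
        (hθhat N hN).aemeasurable).sub_const _)
      (hlinear _ (fun t => loglinearProb W t - w) fun l h1 h2 h3 =>
        isLittleO_loglinearProb_of_isMinPhiDivergence hW hφ hθ₀ h1 h2 h3)
    rwa [← hw, ← hV, hcov'] at this
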